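/- Let $\lambda\in\mathbb C$ with $|\lambda|<1$. Every $x\in[-1,1]$, apart from a countable set of dyadic rationals, has a unique expansion $x=\sum_{n\ge 0}x_n2^{-n-1}$ with $x_n\in\{-1,+1\}$. Let $L_{nm}(x)=1$ if $\sum_{j=n}^m x_j=0$ and $L_{nm}(x)=0$ otherwise, and let $$U(x)=\sum_{0\le n\le m<\infty}\lambda^{m+1}L_{nm}(x)$$ be the loop counting function. Put $Q_n(z)=2^{n+1}z-\lambda z^2-\lambda$ and $z_j=\dfrac{\lambda}{2^j+\sqrt{4^j-\lambda^2}}$ (principal square root), and define the rational functions $$f_n(z)=\frac{2^{n+1}(1+(-1)^n)}{(n+1)Q_n(z)}+\sum_{j=1}^n\ \sum_{n=n_0>n_1>\dots>n_j\ge0}\frac{2^{n_j+1}(1+(-1)^{n_j})}{(n_j+1)Q_{n_j}(z)}\prod_{i=1}^j\frac{\lambda\binom{n_{i-1}}{n_i}\bigl(z^2+(-1)^{n_{i-1}-n_i}\bigr)}{Q_{n_{i-1}}(z)} .$$ Let $\hat f_n$ be the sum of the residues of $f_n$ at the points of the set $\{z_0,\dots,z_n\}$. Say that a function of $\lambda$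 has a closed form of order $A$ if on the whole disc $|\lambda|<1$ it equals $P/Q$, where $P,Q$ are polynomials with integer coefficients, independent of $\lambda$, evaluated at $\lambda,\sqrt{4^0-\lambda^2},\sqrt{4^1-\lambda^2},\dots,\sqrt{4^A-\lambda^2}$, and where $Q$ does not vanish on the disc. Then: 1. For all integers $A,N\ge0$ and $-2^N<c<2^N$, the function $x^AU(x)$ is integrable on $\left[\frac{c-1}{2^N},\frac{c+1}{2^N}\right]$, and $\int_{(c-1)/2^N}^{(c+1)/2^N}x^AU(x)\,dx$ has a closed form of order $A$. 2. For every $j\ge0$ one has $|z_j|<1$, and $z_j$ is the only zero of $Q_j$ in the closed unit disc; if $\lambda\ne0$, the points $z_0,z_1,\dots$ are pairwise distinct. 3. For every $n\ge0$, $\hat f_n=\frac1{2\pi i}\oint_{|z|=1}f_n(z)\,dz$, and $\hat f_n$ has a closed form of order $n$. 4. For every integer $A\ge0$, $$\int_{-1}^1x^AU(x)\,dx=\frac{2^A\bigl((A+1)\hat f_A-1-(-1)^A\bigr)}{(A+1)(2^A-\lambda)}+\sum_{j=1}^A\ \sum_{A=n_0>n_1>\dots>n_j\ge0}\frac{2^{n_j}\bigl((n_j+1)\hat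 f_{n_j}-1-(-1)^{n_j}\bigr)}{(n_j+1)(2^{n_j}-\lambda)}\prod_{i=1}^j\frac{\lambda\binom{n_{i-1}}{n_i}\bigl(1+(-1)^{n_{i-1}-n_i}\bigr)}{2^{n_{i-1}+1}-2\lambda}.$$ -/

import Mathlib

open MeasureTheory Filter Topology

noncomputable section

namespace LoopCounting

/-! ### Signed binary digits and the loop counting function -/

/-- The remainder map: if `x = x₀/2 + x₁/2² + x₂/2³ + ⋯` with `xₙ = ±1`, then `shift x` is
`2x - x₀ = x₁/2 + x₂/2² + ⋯`. -/
def shift (x : ℝ) : ℝ := if 0 ≤ x then 2 * x - 1 else 2 * x + 1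

/-- The digit `xₙ ∈ {-1, +1}` of `x ∈ [-1, 1]` in the expansion `x = ∑ₙ xₙ / 2 ^ (n + 1)`.
The expansion is unique apart from a countable set of dyadic rationals; there, this is
the expansion found greedily. -/
def digit (x : ℝ) (n : ℕ) : ℤ := if 0 ≤ shift^[n] x then 1 else -1

/-- `L_{nm}(x)`: equal to `1` if the steps `xₙ, …, xₘ` form a loop, and `0` otherwise. -/
def loopInd (n m : ℕ) (x : ℝ) : ℂ := if ∑ j ∈ Finset.Icc n m, digit x j = 0 then 1 else 0

/-- The loop counting function `U(x) = ∑_{0 ≤ n ≤ m < ∞} lam ^ (m + 1) L_{nm}(x)`. -/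
def U (lam : ℂ) (x : ℝ) : ℂ :=
  ∑' m : ℕ, ∑ n ∈ Finset.range (m + 1), lam ^ (m + 1) * loopInd n m x

/-- On `[-1, 1]` the digits do expand `x`. -/
theorem hasSum_digit {x : ℝ} (h₁ : -1 ≤ x) (h₂ : x ≤ 1) :
    HasSum (fun n => (digit x n : ℝ) / 2 ^ (n + 1)) x := by
  have hb : ∀ n, |shift^[n] x| ≤ 1 := by
    intro n
    induction n with
    | zero => simpa [abs_le] using ⟨h₁, h₂⟩
    | succ n ih =>
      rw [Function.iterate_succ_apply']
      rw [abs_le] at ih ⊢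
      generalize shift^[n] x = y at ih ⊢
      unfold shift
      split_ifs with h
      · constructor <;> linarith
      · push Not at h
        constructor <;> linarith
  have hs : ∀ n, ∑ i ∈ Finset.range n, (digit x i : ℝ) / 2 ^ (i + 1)
      = x - shift^[n] x / 2 ^ n := by
    intro n
    induction n with
    | zero => simp
    | succ n ih =>
      rw [Finset.sum_range_succ, ih, Function.iterate_succ_apply']
      unfold digit
      generalize shift^[n] x = y
      unfold shift
      split_ifs <;> (push_cast; field_simp; ring)
  have hd : ∀ n, ‖(digit x n : ℝ) / 2 ^ (n + 1)‖ ≤ (1 / 2 : ℝ) ^ n := by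
    intro n
    have h1 : ‖(digit x n : ℝ)‖ = 1 := by unfold digit; split_ifs <;> simp
    rw [norm_div, h1, norm_pow, Real.norm_ofNat, one_div_pow]
    gcongr <;> simp
  have hsum : Summable (fun n => (digit x n : ℝ) / 2 ^ (n + 1)) :=
    Summable.of_norm_bounded summable_geometric_two hd
  rw [hsum.hasSum_iff_tendsto_nat]
  simp only [hs]
  have h0 : Tendsto (fun n : ℕ => shift^[n] x / 2 ^ n) atTop (𝓝 0) := by
    refine squeeze_zero_norm (a := fun n => (1 / 2 : ℝ) ^ n) (fun n => ?_)
      (tendsto_pow_atTop_nhds_zero_of_lt_one (by norm_num) (by norm_num))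
    rw [norm_div, norm_pow, Real.norm_ofNat, one_div_pow]
    exact div_le_div_of_nonneg_right (hb n) (by positivity)
  simpa using tendsto_const_nhds.sub h0

/-- The double series defining `U` converges absolutely. -/
theorem summable_loop {lam : ℂ} (h : ‖lam‖ < 1) (x : ℝ) :
    Summable (fun m : ℕ =>
      ∑ n ∈ Finset.range (m + 1), ‖lam ^ (m + 1) * loopInd n m x‖) := by
  have h1 : Summable (fun m : ℕ => ((m + 1 : ℕ) : ℝ) * ‖lam‖ ^ (m + 1)) := by
    have := summable_pow_mul_geometric_of_norm_lt_one 1 (r := ‖lam‖) (by simpa using h)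
    simpa using (summable_nat_add_iff 1).2 this
  refine Summable.of_nonneg_of_le (fun m => Finset.sum_nonneg fun _ _ => norm_nonneg _)
    (fun m => ?_) h1
  calc ∑ n ∈ Finset.range (m + 1), ‖lam ^ (m + 1) * loopInd n m x‖
      ≤ ∑ _n ∈ Finset.range (m + 1), ‖lam‖ ^ (m + 1) := by
        refine Finset.sum_le_sum fun n _ => ?_
        rw [norm_mul, norm_pow]
        refine mul_le_of_le_one_right (by positivity) ?_
        unfold loopInd
        split_ifs <;> simp
    _ = ((m + 1 : ℕ) : ℝ) * ‖lam‖ ^ (m + 1) := by simp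

/-! ### Closed forms -/

/-- The point `(lam, √(4⁰ - lam²), …, √(4ᴬ - lam²))`, with principal square roots. -/
def radicals (A : ℕ) (lam : ℂ) : Option (Fin (A + 1)) → ℂ
  | none => lam
  | some j => Complex.sqrt (4 ^ (j : ℕ) - lam ^ 2)

/-- The function `I` of `lam` is, on the whole disc `|lam| < 1`, one fixed quotient of polynomials
with integer coefficients in `lam` and the square roots `√(4ʲ - lam²)`, `0 ≤ j ≤ A`, with a
denominator that does not vanish on the disc. -/
def HasClosedForm (A : ℕ) (I : ℂ → ℂ) : Prop :=
  ∃ P Q : MvPolynomial (Option (Fin (A + 1))) ℤ, ∀ lam : ℂ, ‖lam‖ < 1 →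
    MvPolynomial.aeval (radicals A lam) Q ≠ 0 ∧
    I lam = MvPolynomial.aeval (radicals A lam) P / MvPolynomial.aeval (radicals A lam) Q

/-! ### The rational functions `fₙ` and their residues -/

/-- `Qₙ(z) = 2ⁿ⁺¹ z - lam z² - lam`. -/
def quad (lam : ℂ) (n : ℕ) (z : ℂ) : ℂ := 2 ^ (n + 1) * z - lam * z ^ 2 - lam

/-- `zⱼ = lam / (2ʲ + √(4ʲ - lam²))`. -/
def root (lam : ℂ) (j : ℕ) : ℂ := lam / (2 ^ j + Complex.sqrt (4 ^ j - lam ^ 2))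

open Classical in
/-- The chains `n = n₀ > n₁ > ⋯ > nⱼ ≥ 0`. -/
def chains (n j : ℕ) : Finset (Fin (j + 1) → Fin (n + 1)) :=
  Finset.univ.filter fun ν => StrictAnti ν ∧ (ν 0 : ℕ) = n

/-- `bₙ + ∑_{j=1}^{n} ∑_{n = n₀ > n₁ > ⋯ > nⱼ ≥ 0} b_{nⱼ} ∏_{i=1}^{j} K_{nᵢ₋₁, nᵢ}`. -/
def chainSum (b : ℕ → ℂ) (K : ℕ → ℕ → ℂ) (n : ℕ) : ℂ :=
  b n + ∑ j ∈ Finset.Icc 1 n, ∑ ν ∈ chains n j,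
    b (ν (Fin.last j)) * ∏ i : Fin j, K (ν i.castSucc) (ν i.succ)

/-- The rational function
`fₙ(z) = 2ⁿ⁺¹(1+(-1)ⁿ)/((n+1)Qₙ(z)) + ∑ⱼ ∑_{n = n₀ > ⋯ > nⱼ ≥ 0} ⋯`. -/
def f (lam : ℂ) (n : ℕ) (z : ℂ) : ℂ :=
  chainSum (fun k => 2 ^ (k + 1) * (1 + (-1) ^ k) / ((k + 1) * quad lam k z))
    (fun k l => lam * (k.choose l) * (z ^ 2 + (-1) ^ (k - l)) / quad lam k z) n

/-- The residue at `w` of a function that is holomorphic on a punctured neighbourhood of `w`: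
the common value of `(2πi)⁻¹ ∮_{|z - w| = r} g(z) dz` for all small `r > 0`. -/
def residue (g : ℂ → ℂ) (w : ℂ) : ℂ :=
  limUnder (𝓝[>] (0 : ℝ)) fun r => (2 * (Real.pi : ℂ) * Complex.I)⁻¹ * ∮ z in C(w, r), g z

/-- `f̂ₙ`: the sum of the residues of `fₙ` at the points of the set `{z₀, …, zₙ}`
(for `lam ≠ 0` these points are pairwise distinct, for `lam = 0` they coincide). -/
def fHat (lam : ℂ) (n : ℕ) : ℂ :=
  ∑ w ∈ (Finset.range (n + 1)).image (root lam), residue (f lam n) w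

end LoopCounting

end

/-! Let `W_r(x) = ∑ₖ lam ^ k [x₀ + ⋯ + xₖ₋₁ = r]`. Removing the first digit `s` of `x` gives `W_r(x)
= [r = 0] + lam * W_{r-s}(2x - s)` and `U(x) = W_0(x) - 1 + lam * U(2x - s)`. On each half of `[-1,
1]` the digit is constant and `x ↦ 2x - s` maps that half onto `[-1, 1]`. Integrating against `x ^
A` and expanding binomially yields a recursion for the moments `X_r^A = ∫ x ^ A W_r`, triangular in
`A` and coupling `r` to `r ± 1` (`IsMomentFamily`).

The key fact is that this recursion has at most one solution bounded in `r`
(`IsMomentFamily.unique`), while three bounded solutions are at hand: the moments themselves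
(`isMomentFamily_integral`), the Laurent coefficients of `z fₙ(z)` on the unit circle
(`isMomentFamily_laurentCoeff`), and explicit combinations of the powers `zⱼ ^ |r|`
(`isMomentFamily_explicitMoment`). Comparison at `r = 0` gives `∫ x ^ A W_0 = f̂_A`, together with a
closed form of order `A`. That `f̂ₙ` is the unit circle integral follows from Cauchy's formula, the
only poles in the disc being simple.

The moments of `U` over `[-1, 1]` then satisfy a triangular recursion with inhomogeneity built from
`f̂_A`. Its solution is a sum over chains (`eq_chainSum`). Other dyadic intervals are reduced to
`[-1, 1]` by repeatedly removing the first digit, which preserves closed forms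
(`HasClosedMoments.of_shift`). -/

namespace LoopCounting

/-! ### The class of closed forms -/

namespace HasClosedForm

variable {A B : ℕ} {I J : ℂ → ℂ}

theorem congr (h : HasClosedForm A I) (hIJ : ∀ l : ℂ, ‖l‖ < 1 → J l = I l) :
    HasClosedForm A J := by
  obtain ⟨P, Q, hPQ⟩ := h
  exact ⟨P, Q, fun lam hl => ⟨(hPQ lam hl).1, (hIJ lam hl).trans (hPQ lam hl).2⟩⟩

theorem of_aeval (P : MvPolynomial (Option (Fin (A + 1))) ℤ) :
    HasClosedForm A (fun lam => MvPolynomial.aeval (radicals A lam) P) :=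
  ⟨P, 1, fun lam _ => by simp⟩

theorem intCast (k : ℤ) : HasClosedForm A (fun _ => (k : ℂ)) :=
  (of_aeval (MvPolynomial.C k)).congr fun lam _ => by simp

theorem natCast (k : ℕ) : HasClosedForm A (fun _ => (k : ℂ)) :=
  (intCast (k : ℤ)).congr fun lam _ => by simp

theorem param : HasClosedForm A (fun lam => lam) :=
  (of_aeval (MvPolynomial.X none)).congr fun lam _ => by simp [radicals]

theorem sqrt {j : ℕ} (hj : j ≤ A) :
    HasClosedForm A (fun lam => Complex.sqrt (4 ^ j - lam ^ 2)) :=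
  (of_aeval (MvPolynomial.X (some ⟨j, Nat.lt_succ_of_le hj⟩))).congr fun lam _ => by
    simp [radicals]

theorem add (hI : HasClosedForm A I) (hJ : HasClosedForm A J) :
    HasClosedForm A (fun lam => I lam + J lam) := by
  obtain ⟨P, Q, hPQ⟩ := hI
  obtain ⟨R, S, hRS⟩ := hJ
  refine ⟨P * S + Q * R, Q * S, fun lam hl => ?_⟩
  obtain ⟨hQ, hI⟩ := hPQ lam hl
  obtain ⟨hS, hJ⟩ := hRS lam hl
  simp only [map_mul, map_add, hI, hJ]
  exact ⟨mul_ne_zero hQ hS, div_add_div _ _ hQ hS⟩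

theorem mul (hI : HasClosedForm A I) (hJ : HasClosedForm A J) :
    HasClosedForm A (fun lam => I lam * J lam) := by
  obtain ⟨P, Q, hPQ⟩ := hI
  obtain ⟨R, S, hRS⟩ := hJ
  refine ⟨P * R, Q * S, fun lam hl => ?_⟩
  obtain ⟨hQ, hI⟩ := hPQ lam hl
  obtain ⟨hS, hJ⟩ := hRS lam hl
  simp only [map_mul, hI, hJ]
  exact ⟨mul_ne_zero hQ hS, div_mul_div_comm _ _ _ _⟩

theorem neg (hI : HasClosedForm A I) : HasClosedForm A (fun lam => -I lam) :=
  ((intCast (-1)).mul hI).congr fun lam _ => by simp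

theorem sub (hI : HasClosedForm A I) (hJ : HasClosedForm A J) :
    HasClosedForm A (fun lam => I lam - J lam) :=
  (hI.add hJ.neg).congr fun _ _ => sub_eq_add_neg _ _

theorem inv (hI : HasClosedForm A I) (h0 : ∀ l : ℂ, ‖l‖ < 1 → I l ≠ 0) :
    HasClosedForm A (fun lam => (I lam)⁻¹) := by
  obtain ⟨P, Q, hPQ⟩ := hI
  refine ⟨Q, P, fun lam hl => ?_⟩
  have h := h0 lam hl
  obtain ⟨hQ, hI⟩ := hPQ lam hl
  simp only [hI] at h ⊢
  exact ⟨(div_ne_zero_iff.1 h).1, inv_div _ _⟩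

theorem div (hI : HasClosedForm A I) (hJ : HasClosedForm A J)
    (h0 : ∀ l : ℂ, ‖l‖ < 1 → J l ≠ 0) : HasClosedForm A (fun lam => I lam / J lam) :=
  (hI.mul (hJ.inv h0)).congr fun _ _ => div_eq_mul_inv _ _

theorem ratCast (q : ℚ) : HasClosedForm A (fun _ => (q : ℂ)) :=
  ((intCast q.num).div (natCast q.den) fun _ _ => by simp).congr fun lam _ => by
    exact_mod_cast congrArg (fun x : ℚ => (x : ℂ)) (Rat.num_div_den q).symm

theorem const {a : ℂ} (q : ℚ) (h : (q : ℂ) = a) : HasClosedForm A (fun _ => a) :=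
  (ratCast q).congr fun _ _ => h.symm

theorem pow (hI : HasClosedForm A I) (k : ℕ) : HasClosedForm A (fun lam => I lam ^ k) := by
  induction k with
  | zero => exact const 1 (by simp) |>.congr fun _ _ => pow_zero _
  | succ k ih => exact (ih.mul hI).congr fun _ _ => pow_succ _ _

theorem sum {ι : Type*} (s : Finset ι) {I : ι → ℂ → ℂ} (h : ∀ i ∈ s, HasClosedForm A (I i)) :
    HasClosedForm A (fun lam => ∑ i ∈ s, I i lam) := by
  classical
  induction s using Finset.induction_on with
  | empty => simpa using natCast (A := A) 0
  | insert a s ha ih =>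
    simp only [Finset.sum_insert ha]
    exact (h a (by simp)).add (ih fun i hi => h i (by simp [hi]))

theorem mono (hI : HasClosedForm A I) (hAB : A ≤ B) : HasClosedForm B I := by
  obtain ⟨P, Q, hPQ⟩ := hI
  have hr : ∀ lam, radicals B lam ∘ Option.map (Fin.castLE (Nat.succ_le_succ hAB)) =
      radicals A lam := by
    intro lam
    funext o
    cases o <;> rfl
  refine ⟨MvPolynomial.rename (Option.map (Fin.castLE (Nat.succ_le_succ hAB))) P,
    MvPolynomial.rename (Option.map (Fin.castLE (Nat.succ_le_succ hAB))) Q, fun lam hl => ?_⟩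
  simp only [MvPolynomial.aeval_rename, hr]
  exact hPQ lam hl

end HasClosedForm

/-! ### The roots of the quadratics -/

theorem re_sqrt_nonneg (a : ℂ) : 0 ≤ (Complex.sqrt a).re := by
  rw [Complex.sqrt, Complex.cpow_inv_two_re]
  positivity

theorem sq_sqrt (a : ℂ) : Complex.sqrt a ^ 2 = a := by
  rw [Complex.sqrt]
  simp

/-- The principal root has nonnegative real part, so the real part of the sum is already at least `2
^ j`. This choice of branch is what places `zⱼ` inside the disc. -/
theorem one_le_norm_two_pow_add_sqrt (lam : ℂ) (j : ℕ) :
    1 ≤ ‖(2 : ℂ) ^ j + Complex.sqrt (4 ^ j - lam ^ 2)‖ := by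
  have h1 : (1 : ℝ) ≤ 2 ^ j := one_le_pow₀ (by norm_num)
  have h2 : ((2 : ℂ) ^ j).re = 2 ^ j := by
    rw [show (2 : ℂ) ^ j = ((2 ^ j : ℝ) : ℂ) by push_cast; rfl, Complex.ofReal_re]
  have h := Complex.re_le_norm ((2 : ℂ) ^ j + Complex.sqrt (4 ^ j - lam ^ 2))
  rw [Complex.add_re, h2] at h
  linarith [re_sqrt_nonneg (4 ^ j - lam ^ 2)]

theorem two_pow_add_sqrt_ne_zero (lam : ℂ) (j : ℕ) :
    (2 : ℂ) ^ j + Complex.sqrt (4 ^ j - lam ^ 2) ≠ 0 :=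
  norm_pos_iff.1 (one_pos.trans_le (one_le_norm_two_pow_add_sqrt lam j))

theorem norm_root_le (lam : ℂ) (j : ℕ) : ‖root lam j‖ ≤ ‖lam‖ := by
  rw [root, norm_div]
  exact div_le_self (norm_nonneg _) (one_le_norm_two_pow_add_sqrt lam j)

theorem quad_root (lam : ℂ) (j : ℕ) : quad lam j (root lam j) = 0 := by
  have h0 := two_pow_add_sqrt_ne_zero lam j
  have h := sq_sqrt (4 ^ j - lam ^ 2)
  have h4 : (4 : ℂ) ^ j = (2 ^ j) ^ 2 := by rw [← pow_mul, mul_comm, pow_mul]; norm_num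
  rw [quad, root]
  generalize Complex.sqrt (4 ^ j - lam ^ 2) = s at *
  field_simp
  rw [h4] at h
  ring_nf at h ⊢
  linear_combination -lam * h

/-- Keeping the second factor undivided, instead of naming the other root `2 ^ (j + 1) / lam - zⱼ`,
includes the case `lam = 0`. -/
theorem quad_eq_mul (lam : ℂ) (j : ℕ) (z : ℂ) :
    quad lam j z = (z - root lam j) * (2 ^ (j + 1) - lam * (z + root lam j)) := by
  have h := quad_root lam j
  rw [quad] at h ⊢
  linear_combination h

/-- The first term has modulus at least 2, the second less than 2. -/
theorem cofactor_ne_zero {lam : ℂ} (hl : ‖lam‖ < 1) (j : ℕ) {z : ℂ} (hz : ‖z‖ ≤ 1) :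
    2 ^ (j + 1) - lam * (z + root lam j) ≠ 0 := by
  intro h
  have h1 : (2 : ℝ) ^ (j + 1) ≤ ‖lam‖ * (‖z‖ + ‖root lam j‖) := by
    have : ‖(2 : ℂ) ^ (j + 1)‖ = 2 ^ (j + 1) := by simp
    rw [← this, sub_eq_zero.1 h, norm_mul]
    gcongr
    exact norm_add_le _ _
  have h2 : (2 : ℝ) ≤ 2 ^ (j + 1) := by
    rw [pow_succ]; linarith [one_le_pow₀ (M₀ := ℝ) (a := 2) (by norm_num) (n := j)]
  have h3 := norm_root_le lam j
  nlinarith [norm_nonneg lam]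

theorem quad_eq_zero_iff {lam : ℂ} (hl : ‖lam‖ < 1) (j : ℕ) {z : ℂ} (hz : ‖z‖ ≤ 1) :
    quad lam j z = 0 ↔ z = root lam j := by
  rw [quad_eq_mul, mul_eq_zero, or_iff_left (cofactor_ne_zero hl j hz), sub_eq_zero]

theorem quad_ne_zero_of_norm_eq_one {lam : ℂ} (hl : ‖lam‖ < 1) (j : ℕ) {z : ℂ} (hz : ‖z‖ = 1) :
    quad lam j z ≠ 0 := by
  rw [Ne, quad_eq_zero_iff hl j hz.le]
  rintro rfl
  linarith [norm_root_le lam j]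

/-- A common root of `Qᵢ` and `Qⱼ` is a root of the difference `(2 ^ (i + 1) - 2 ^ (j + 1)) z`, and
it is nonzero because `lam ≠ 0`. -/
theorem root_injective {lam : ℂ} (h0 : lam ≠ 0) : Function.Injective (root lam) := by
  intro i j hij
  have hi := quad_root lam i
  have hj := quad_root lam j
  rw [← hij] at hj
  have hz : root lam i ≠ 0 := div_ne_zero h0 (two_pow_add_sqrt_ne_zero lam i)
  have h : ((2 : ℂ) ^ (i + 1) - 2 ^ (j + 1)) * root lam i = 0 := by
    rw [quad] at hi hj
    linear_combination hi - hj
  have h2 : (2 : ℂ) ^ (i + 1) = 2 ^ (j + 1) :=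
    sub_eq_zero.1 ((mul_eq_zero.1 h).resolve_right hz)
  have h3 : (2 : ℕ) ^ (i + 1) = 2 ^ (j + 1) := by exact_mod_cast h2
  have := Nat.pow_right_injective le_rfl h3
  omega

theorem hasClosedForm_root {A j : ℕ} (hj : j ≤ A) : HasClosedForm A (fun lam => root lam j) :=
  HasClosedForm.param.div ((HasClosedForm.const (2 ^ j) (by simp)).add (HasClosedForm.sqrt hj))
    fun lam _ => two_pow_add_sqrt_ne_zero lam j

/-! ### Sums over chains -/

section Chains

variable (b : ℕ → ℂ) (K : ℕ → ℕ → ℂ)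

/-- The part of `chainSum` coming from the chains with `j` steps. -/
noncomputable def chainPart (j n : ℕ) : ℂ :=
  ∑ ν ∈ chains n j, b (ν (Fin.last j)) * ∏ i : Fin j, K (ν i.castSucc) (ν i.succ)

theorem mem_chains {n j : ℕ} {ν : Fin (j + 1) → Fin (n + 1)} :
    ν ∈ chains n j ↔ StrictAnti ν ∧ (ν 0 : ℕ) = n := by
  simp [chains]

theorem chainPart_zero (n : ℕ) : chainPart b K 0 n = b n := by
  have : Subsingleton (Fin (0 + 1)) := inferInstanceAs (Subsingleton (Fin 1))
  have h : chains n 0 = {fun _ => Fin.last n} := by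
    ext ν
    rw [mem_chains, Finset.mem_singleton]
    constructor
    · rintro ⟨-, h⟩
      funext i
      rw [Subsingleton.elim i 0]
      exact Fin.ext h
    · rintro rfl
      exact ⟨Subsingleton.strictAnti _, rfl⟩
  simp [chainPart, h]

/-- Removing `n₀ = n` from a chain leaves a chain that starts at `l = n₁ < n`. The bijection is
`Fin.cons`, with the entries re-typed from `Fin (l + 1)` to `Fin (n + 1)`. -/
theorem chainPart_succ (j n : ℕ) :
    chainPart b K (j + 1) n = ∑ l ∈ Finset.range n, K n l * chainPart b K j l := by
  simp only [chainPart, Finset.mul_sum]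
  rw [Finset.sum_sigma']
  symm
  have hlt : ∀ p ∈ (Finset.range n).sigma fun l => chains l j, ∀ i, (p.2 i : ℕ) < n := by
    rintro ⟨l, μ⟩ hp i
    have := Finset.mem_range.1 (Finset.mem_sigma.1 hp).1
    have := (μ i).2
    simp only at *
    omega
  refine Finset.sum_bij (fun p hp => Fin.cons (Fin.last n)
    fun i => ⟨(p.2 i : ℕ), (hlt p hp i).trans n.lt_succ_self⟩) ?_ ?_ ?_ ?_
  · rintro ⟨l, μ⟩ hp
    obtain ⟨hμ, -⟩ := mem_chains.1 (Finset.mem_sigma.1 hp).2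
    refine mem_chains.2 ⟨Fin.strictAnti_iff_succ_lt.2 fun i => ?_, rfl⟩
    refine Fin.cases ?_ (fun i => ?_) i
    · simpa [Fin.lt_def] using hlt ⟨l, μ⟩ hp 0
    · exact hμ i.castSucc_lt_succ
  · rintro ⟨l, μ⟩ hp ⟨l', μ'⟩ hp' h
    have h2 := (mem_chains.1 (Finset.mem_sigma.1 hp).2).2
    have h2' := (mem_chains.1 (Finset.mem_sigma.1 hp').2).2
    have hv : ∀ i, (μ i : ℕ) = μ' i := fun i => by
      have := congrArg Fin.val (congrFun h i.succ)
      simpa using this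
    obtain rfl : l = l' := h2.symm.trans ((hv 0).trans h2')
    congr 1
    funext i
    exact Fin.ext (hv i)
  · intro ν hν
    obtain ⟨hν, h0⟩ := mem_chains.1 hν
    have hle : ∀ i : Fin (j + 1), (ν i.succ : ℕ) ≤ ν 1 := fun i =>
      hν.antitone (Fin.succ_le_succ_iff.2 (Fin.zero_le i) : (0 : Fin (j + 1)).succ ≤ i.succ)
    refine ⟨⟨ν 1, fun i => ⟨ν i.succ, Nat.lt_succ_of_le (hle i)⟩⟩, ?_, ?_⟩
    · refine Finset.mem_sigma.2 ⟨Finset.mem_range.2 ?_, mem_chains.2 ⟨fun i k hik => ?_, rfl⟩⟩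
      · have : ν 1 < ν 0 := hν (Fin.succ_pos (0 : Fin (j + 1)))
        simpa [h0] using Fin.lt_def.1 this
      · exact hν (Fin.succ_lt_succ_iff.2 hik)
    · funext i
      refine Fin.cases ?_ (fun i => ?_) i
      · exact Fin.ext h0.symm
      · rfl
  · rintro ⟨l, μ⟩ hp
    have h2 := (mem_chains.1 (Finset.mem_sigma.1 hp).2).2
    rw [Fin.prod_univ_succ]
    simp only at h2
    simp only [← Fin.succ_last, Fin.cons_succ, Fin.castSucc_zero, Fin.cons_zero, Fin.val_last, h2,
      ← Fin.succ_castSucc]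
    ring

theorem chainPart_eq_zero {j n : ℕ} (h : n < j) : chainPart b K j n = 0 := by
  induction j generalizing n with
  | zero => omega
  | succ j ih =>
    rw [chainPart_succ]
    refine Finset.sum_eq_zero fun l hl => ?_
    rw [ih (by have := Finset.mem_range.1 hl; omega), mul_zero]

/-- Chains with more than `n` steps do not exist, so the bound `N` is free. A bound common to all `l
< n` permits the exchange of sums in `chainSum_rec`. -/
theorem chainSum_eq_sum_chainPart {n N : ℕ} (h : n < N) :
    chainSum b K n = ∑ j ∈ Finset.range N, chainPart b K j n := by
  have h1 : chainSum b K n = ∑ j ∈ Finset.range (n + 1), chainPart b K j n := by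
    rw [Finset.sum_range_succ', chainPart_zero, chainSum, add_comm, Finset.range_eq_Ico,
      Finset.sum_Ico_add' (fun j => chainPart b K j n) 0 n 1]
    rfl
  rw [h1]
  refine Finset.sum_subset (Finset.range_subset_range.2 h) fun j _ hj => ?_
  exact chainPart_eq_zero b K (by simpa using hj)

theorem chainSum_rec (n : ℕ) :
    chainSum b K n = b n + ∑ l ∈ Finset.range n, K n l * chainSum b K l := by
  rw [chainSum_eq_sum_chainPart b K (n.lt_succ_self), Finset.sum_range_succ', chainPart_zero,
    add_comm]
  simp only [chainPart_succ]
  rw [Finset.sum_comm]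
  congr 1
  refine Finset.sum_congr rfl fun l hl => ?_
  rw [chainSum_eq_sum_chainPart b K (Finset.mem_range.1 hl), Finset.mul_sum]

/-- A sequence satisfying the recursion of `chainSum` is equal to it. -/
theorem eq_chainSum {a : ℕ → ℂ} (h : ∀ n, a n = b n + ∑ l ∈ Finset.range n, K n l * a l) (n : ℕ) :
    a n = chainSum b K n := by
  induction n using Nat.strong_induction_on with
  | _ n ih =>
    rw [h, chainSum_rec]
    congr 1
    exact Finset.sum_congr rfl fun l hl => by rw [ih l (Finset.mem_range.1 hl)]

end Chains

/-! ### Residues of functions with simple poles in the unit disc -/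

/-- On the closed unit disc, `g` is the quotient of a function that is holomorphic in the interior
and continuous up to the boundary by `∏ w ∈ S, (z - w)`. -/
def HasSimplePoles (S : Finset ℂ) (g : ℂ → ℂ) : Prop :=
  ∃ G : ℂ → ℂ, DiffContOnCl ℂ G (Metric.ball 0 1) ∧
    ∀ z ∉ S, ‖z‖ ≤ 1 → g z * ∏ w ∈ S, (z - w) = G z

namespace HasSimplePoles

variable {S T : Finset ℂ} {g h : ℂ → ℂ}

theorem of_diffContOnCl (hg : DiffContOnCl ℂ g (Metric.ball 0 1)) : HasSimplePoles ∅ g :=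
  ⟨g, hg, fun z _ _ => by simp⟩

theorem mul_diffContOnCl (hg : HasSimplePoles S g) (hh : DiffContOnCl ℂ h (Metric.ball 0 1)) :
    HasSimplePoles S (fun z => h z * g z) := by
  obtain ⟨G, hG, hgG⟩ := hg
  refine ⟨fun z => h z * G z, hh.smul hG, fun z hz h1 => ?_⟩
  beta_reduce
  rw [← hgG z hz h1, mul_assoc]

theorem mono (hg : HasSimplePoles S g) (hST : S ⊆ T) : HasSimplePoles T g := by
  classical
  obtain ⟨G, hG, hgG⟩ := hg
  have hd : Differentiable ℂ fun z : ℂ => ∏ w ∈ T \ S, (z - w) := by fun_prop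
  refine ⟨fun z => (∏ w ∈ T \ S, (z - w)) * G z, hd.diffContOnCl.smul hG, fun z hz h1 => ?_⟩
  beta_reduce
  rw [← hgG z (fun h => hz (hST h)) h1, ← Finset.prod_sdiff hST]
  ring

theorem add (hg : HasSimplePoles S g) (hh : HasSimplePoles S h) :
    HasSimplePoles S (fun z => g z + h z) := by
  obtain ⟨G, hG, hgG⟩ := hg
  obtain ⟨H, hH, hhH⟩ := hh
  refine ⟨fun z => G z + H z, hG.add hH, fun z hz h1 => ?_⟩
  beta_reduce
  rw [← hgG z hz h1, ← hhH z hz h1, add_mul]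

theorem sum {ι : Type*} (s : Finset ι) {g : ι → ℂ → ℂ} (hg : ∀ i ∈ s, HasSimplePoles S (g i)) :
    HasSimplePoles S (fun z => ∑ i ∈ s, g i z) := by
  classical
  induction s using Finset.induction_on with
  | empty => simpa using (of_diffContOnCl diffContOnCl_const).mono (Finset.empty_subset S)
  | insert a s ha ih =>
    simp only [Finset.sum_insert ha]
    exact (hg a (by simp)).add (ih fun i hi => hg i (by simp [hi]))

theorem div_sub [DecidableEq ℂ] {w : ℂ} (hg : HasSimplePoles S g) (hw : w ∉ S) :
    HasSimplePoles (insert w S) (fun z => g z / (z - w)) := by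
  obtain ⟨G, hG, hgG⟩ := hg
  refine ⟨G, hG, fun z hz h1 => ?_⟩
  rw [Finset.mem_insert, not_or] at hz
  rw [← hgG z hz.2 h1, Finset.prod_insert hw, ← mul_assoc, div_mul_cancel₀ _ (sub_ne_zero.2 hz.1)]

/-- Partial fractions. -/
theorem exists_eq_sum (hg : HasSimplePoles S g) (hS : S.Nonempty) :
    ∃ (c : ℂ → ℂ) (G : ℂ → ℂ), DiffContOnCl ℂ G (Metric.ball 0 1) ∧
      ∀ z ∉ S, ‖z‖ ≤ 1 → g z = ∑ w ∈ S, c w * ((z - w)⁻¹ * G z) := by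
  classical
  obtain ⟨G, hG, hgG⟩ := hg
  refine ⟨Lagrange.nodalWeight S id, G, hG, fun z hz h1 => ?_⟩
  -- Interpolating the constant 1 at the nodes `S` gives `1 = ∏ (z - w) * ∑ c w / (z - w)`.
  -- Multiplying by `g z` turns the product into `G z`.
  have h := Lagrange.eval_interpolate_not_at_node (s := S) (v := id) (x := z) 1
    (fun i hi => by rintro rfl; exact hz hi)
  rw [Lagrange.interpolate_one (Set.injOn_id _) hS, Polynomial.eval_one, Lagrange.eval_nodal] at h
  simp only [id, Pi.one_apply, mul_one] at h
  rw [← mul_one (g z), h, ← mul_assoc, hgG z hz h1, Finset.mul_sum]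
  exact Finset.sum_congr rfl fun w _ => by ring

/-- In the decomposition `g = ∑ c w * G z / (z - w)`, Cauchy's formula on the unit circle evaluates
every term to `2πi * c w * G w`. On a small circle about `a ∈ S` only the term `w = a` survives, the
others being holomorphic there. -/
theorem circleIntegral_eq_sum_residue (hg : HasSimplePoles S g) (hS : S.Nonempty)
    (hS1 : ∀ w ∈ S, ‖w‖ < 1) :
    ∑ w ∈ S, residue g w = (2 * (Real.pi : ℂ) * Complex.I)⁻¹ * ∮ z in C(0, 1), g z := by
  obtain ⟨c, G, hG, hgG⟩ := hg.exists_eq_sum hS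
  have hcont : ContinuousOn G (Metric.closedBall 0 1) := hG.continuousOn_ball
  have hterm : ∀ (a : ℂ) (r : ℝ), 0 < r → Metric.closedBall a r ⊆ Metric.closedBall 0 1 →
      (∀ w ∈ S, w ∉ Metric.sphere a r) → (∮ z in C(a, r), g z) =
        ∑ w ∈ S, c w * ∮ z in C(a, r), (z - w)⁻¹ * G z := by
    intro a r hr hsub hS2
    have hsph : Metric.sphere a r ⊆ Metric.closedBall 0 1 :=
      Metric.sphere_subset_closedBall.trans hsub
    have h1 : (∮ z in C(a, r), g z) = ∮ z in C(a, r), ∑ w ∈ S, c w * ((z - w)⁻¹ * G z) := by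
      refine circleIntegral.integral_congr hr.le fun z hz => ?_
      exact hgG z (fun h => hS2 z h hz) (by simpa using hsph hz)
    rw [h1, circleIntegral.integral_fun_sum]
    · exact Finset.sum_congr rfl fun w _ => circleIntegral.integral_const_mul _ _ _ _
    · intro w hw
      refine ContinuousOn.circleIntegrable hr.le ?_
      refine continuousOn_const.mul (ContinuousOn.mul (ContinuousOn.inv₀ (by fun_prop) ?_)
        (hcont.mono hsph))
      intro z hz h
      rw [sub_eq_zero.1 h] at hz
      exact hS2 w hw hz
  have hpi : (2 * (Real.pi : ℂ) * Complex.I) ≠ 0 := Complex.two_pi_I_ne_zero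
  have hbig : (∮ z in C(0, 1), g z) = ∑ w ∈ S, c w * (2 * (Real.pi : ℂ) * Complex.I * G w) := by
    rw [hterm 0 1 one_pos subset_rfl fun w hw h => by
      have := hS1 w hw
      rw [mem_sphere_zero_iff_norm] at h
      linarith]
    refine Finset.sum_congr rfl fun w hw => ?_
    have := hG.circleIntegral_sub_inv_smul (mem_ball_zero_iff.2 (hS1 w hw))
    simp only [smul_eq_mul] at this
    rw [this]
  have hres : ∀ a ∈ S, residue g a = c a * G a := by
    intro a ha
    have hopen : IsOpen (Metric.ball (0 : ℂ) 1 \ (S.erase a : Set ℂ)) :=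
      Metric.isOpen_ball.sdiff (S.erase a).finite_toSet.isClosed
    obtain ⟨ε, hε, hsub⟩ := Metric.isOpen_iff.1 hopen a
      ⟨mem_ball_zero_iff.2 (hS1 a ha), by simp⟩
    -- The limit defining the residue is that of a function constant for `0 < r < ε`.
    refine Tendsto.limUnder_eq (tendsto_const_nhds.congr' ?_)
    filter_upwards [Ioo_mem_nhdsGT hε] with r hr
    have hsub' : Metric.closedBall a r ⊆ Metric.ball (0 : ℂ) 1 \ (S.erase a : Set ℂ) :=
      (Metric.closedBall_subset_ball hr.2).trans hsub
    have hball : Metric.closedBall a r ⊆ Metric.ball (0 : ℂ) 1 := fun z hz => (hsub' hz).1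
    have hne : ∀ w ∈ S, w ≠ a → w ∉ Metric.closedBall a r := fun w hw hwa h =>
      (hsub' h).2 (by simp [hw, hwa])
    have hGd : DifferentiableOn ℂ G (Metric.closedBall a r) := hG.differentiableOn.mono hball
    rw [hterm a r hr.1 (hball.trans Metric.ball_subset_closedBall), Finset.sum_eq_single_of_mem a ha]
    · have := hGd.circleIntegral_sub_inv_smul (Metric.mem_ball_self hr.1)
      simp only [smul_eq_mul] at this
      rw [this]
      field_simp
    · intro w hw hwa
      have hd : DifferentiableOn ℂ (fun z => (z - w)⁻¹ * G z) (Metric.closedBall a r) := by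
        refine DifferentiableOn.mul (DifferentiableOn.inv (by fun_prop) fun z hz h => ?_) hGd
        rw [sub_eq_zero.1 h] at hz
        exact hne w hw hwa hz
      have := (hd.mono Metric.closure_ball_subset_closedBall).diffContOnCl.circleIntegral_eq_zero
        hr.1.le
      rw [this, mul_zero]
    · intro w hw h
      rcases eq_or_ne w a with rfl | hwa
      · simp [hr.1.ne] at h
      · exact hne w hw hwa (Metric.sphere_subset_closedBall h)
  rw [hbig, Finset.mul_sum]
  refine Finset.sum_congr rfl fun w hw => ?_
  rw [hres w hw]
  field_simp

end HasSimplePoles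

/-! ### The rational functions `fₙ` -/

theorem f_rec (lam : ℂ) (n : ℕ) (z : ℂ) :
    f lam n z = (2 ^ (n + 1) * (1 + (-1) ^ n) / (n + 1) +
      ∑ l ∈ Finset.range n, lam * (n.choose l) * (z ^ 2 + (-1) ^ (n - l)) * f lam l z) /
        quad lam n z := by
  rw [f, chainSum_rec, add_div, Finset.sum_div, div_div]
  congr 1
  exact Finset.sum_congr rfl fun l _ => by rw [f]; ring

/-- By `f_rec`, passing from the `f_l` with `l < n` to `fₙ` costs one division by `Qₙ`, hence one
new pole `zₙ`. It differs from the earlier ones since `lam ≠ 0`, so all poles stay simple. -/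
theorem hasSimplePoles_f {lam : ℂ} (hl : ‖lam‖ < 1) (h0 : lam ≠ 0) [DecidableEq ℂ] (n : ℕ) :
    HasSimplePoles ((Finset.range (n + 1)).image (root lam)) (f lam n) := by
  induction n using Nat.strong_induction_on with
  | _ n ih =>
    have hnum : HasSimplePoles ((Finset.range n).image (root lam)) (fun z =>
        2 ^ (n + 1) * (1 + (-1) ^ n) / (n + 1) +
          ∑ l ∈ Finset.range n, lam * (n.choose l) * (z ^ 2 + (-1) ^ (n - l)) * f lam l z) := by
      refine HasSimplePoles.add ((HasSimplePoles.of_diffContOnCl diffContOnCl_const).mono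
        (Finset.empty_subset _)) (HasSimplePoles.sum _ fun l hl => ?_)
      have hl' := Finset.mem_range.1 hl
      refine ((ih l hl').mono (Finset.image_subset_image
        (Finset.range_subset_range.2 hl'))).mul_diffContOnCl (Differentiable.diffContOnCl ?_)
      fun_prop
    have hcof : DiffContOnCl ℂ (fun z => (2 ^ (n + 1) - lam * (z + root lam n))⁻¹)
        (Metric.ball 0 1) := by
      refine DiffContOnCl.inv (Differentiable.diffContOnCl (by fun_prop)) fun z hz => ?_
      rw [closure_ball _ one_ne_zero, mem_closedBall_zero_iff] at hz
      exact cofactor_ne_zero hl n hz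
    rw [Finset.range_add_one, Finset.image_insert]
    have hn : root lam n ∉ (Finset.range n).image (root lam) := by
      intro h
      obtain ⟨i, hi, hin⟩ := Finset.mem_image.1 h
      exact (Finset.mem_range.1 hi).ne (root_injective h0 hin)
    convert (hnum.mul_diffContOnCl hcof).div_sub hn using 2 with z
    rw [f_rec, quad_eq_mul, mul_comm (z - _), ← div_div, div_eq_inv_mul _ (2 ^ (n + 1) - _)]

/-- For `lam = 0` all roots collapse to 0, but the coupling terms vanish too and `fₙ` is a multiple
of `1 / z`. -/
theorem hasSimplePoles_f_zero (n : ℕ) : HasSimplePoles {0} (f 0 n) := by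
  classical
  have h : f 0 n = fun z => ((1 + (-1) ^ n) / (n + 1) : ℂ) / (z - 0) := by
    funext z
    rw [f_rec, quad]
    have h2 : (2 : ℂ) ^ (n + 1) ≠ 0 := pow_ne_zero _ two_ne_zero
    simp only [zero_mul, Finset.sum_const_zero, add_zero, sub_zero]
    rw [div_div, div_div, mul_left_comm, mul_div_mul_left _ _ h2]
  rw [h]
  exact (HasSimplePoles.of_diffContOnCl diffContOnCl_const).div_sub (Finset.notMem_empty 0)

theorem fHat_eq_circleIntegral {lam : ℂ} (hl : ‖lam‖ < 1) (n : ℕ) :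
    fHat lam n = (2 * (Real.pi : ℂ) * Complex.I)⁻¹ * ∮ z in C(0, 1), f lam n z := by
  classical
  have key : HasSimplePoles ((Finset.range (n + 1)).image (root lam)) (f lam n) := by
    rcases eq_or_ne lam 0 with rfl | h0
    · have : (Finset.range (n + 1)).image (root 0) = {0} := by
        rw [← Finset.image_const (s := Finset.range (n + 1)) ⟨0, by simp⟩ (0 : ℂ)]
        exact Finset.image_congr fun j _ => by simp [root]
      rw [this]
      exact hasSimplePoles_f_zero n
    · exact hasSimplePoles_f hl h0 n
  rw [← key.circleIntegral_eq_sum_residue ⟨root lam 0, Finset.mem_image_of_mem _ (by simp)⟩, fHat]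
  intro w hw
  obtain ⟨j, -, rfl⟩ := Finset.mem_image.1 hw
  exact (norm_root_le lam j).trans_lt hl

/-! ### The moment recursion -/

/-- The family `X r A` is bounded in `r` and satisfies the recursion of the moments
`∫_{-1}^1 x ^ A W_r(x) dx`, where `W_r(x) = ∑ₖ lam ^ k [x₀ + ⋯ + xₖ₋₁ = r]`. -/
structure IsMomentFamily (lam : ℂ) (X : ℤ → ℕ → ℂ) : Prop where
  bounded : ∀ A, ∃ C, ∀ r, ‖X r A‖ ≤ C
  eq_rec : ∀ r A, X r A = (if r = 0 then (1 + (-1) ^ A) / ((A : ℂ) + 1) else 0) +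
    lam / 2 ^ (A + 1) * ∑ l ∈ Finset.range (A + 1),
      (A.choose l : ℂ) * (X (r - 1) l + (-1) ^ (A - l) * X (r + 1) l)

/-- Once the levels below `A` agree, the difference satisfies `d_r = lam / 2 ^ (A + 1) * (d_{r-1} +
d_{r+1})`. Its supremum over `r`, finite by boundedness, therefore shrinks by the factor `‖lam‖` at
each application. -/
theorem IsMomentFamily.unique {lam : ℂ} (hl : ‖lam‖ < 1) {X Y : ℤ → ℕ → ℂ}
    (hX : IsMomentFamily lam X) (hY : IsMomentFamily lam Y) (r : ℤ) (A : ℕ) : X r A = Y r A := by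
  induction A using Nat.strong_induction_on generalizing r with
  | _ A ih =>
    have hd : ∀ r, X r A - Y r A = lam / 2 ^ (A + 1) *
        ((X (r - 1) A - Y (r - 1) A) + (X (r + 1) A - Y (r + 1) A)) := by
      intro r
      have h : ∑ l ∈ Finset.range A, (A.choose l : ℂ) *
            (X (r - 1) l + (-1) ^ (A - l) * X (r + 1) l) =
          ∑ l ∈ Finset.range A, (A.choose l : ℂ) *
            (Y (r - 1) l + (-1) ^ (A - l) * Y (r + 1) l) :=
        Finset.sum_congr rfl fun l hl => by
          rw [ih l (Finset.mem_range.1 hl), ih l (Finset.mem_range.1 hl)]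
      rw [hX.eq_rec r A, hY.eq_rec r A, Finset.sum_range_succ, Finset.sum_range_succ, h]
      simp only [Nat.choose_self, Nat.sub_self, pow_zero, Nat.cast_one]
      ring
    obtain ⟨C, hC⟩ := hX.bounded A
    obtain ⟨D, hD⟩ := hY.bounded A
    have hbound : ∀ (n : ℕ) (r : ℤ), ‖X r A - Y r A‖ ≤ ‖lam‖ ^ n * (C + D) := by
      intro n
      induction n with
      | zero =>
        intro r
        rw [pow_zero, one_mul]
        exact (norm_sub_le _ _).trans (add_le_add (hC r) (hD r))
      | succ n ihn =>
        intro r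
        have h2 : ‖lam / 2 ^ (A + 1)‖ ≤ ‖lam‖ / 2 := by
          rw [norm_div, norm_pow, Complex.norm_ofNat, pow_succ]
          have : (1 : ℝ) ≤ 2 ^ A := one_le_pow₀ (by norm_num)
          gcongr
          linarith
        rw [hd, norm_mul]
        calc _ ≤ ‖lam‖ / 2 * (‖lam‖ ^ n * (C + D) + ‖lam‖ ^ n * (C + D)) := by
              gcongr
              exact (norm_add_le _ _).trans (add_le_add (ihn _) (ihn _))
          _ = _ := by ring
    have hlim : Tendsto (fun n => ‖lam‖ ^ n * (C + D)) atTop (𝓝 0) := by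
      simpa using (tendsto_pow_atTop_nhds_zero_of_lt_one (norm_nonneg _) hl).mul_const (C + D)
    have := ge_of_tendsto' hlim fun n => hbound n r
    exact sub_eq_zero.1 (norm_le_zero_iff.1 this)

/-! ### The Laurent coefficients of `fₙ` on the unit circle -/

theorem continuousOn_f {lam : ℂ} (hl : ‖lam‖ < 1) (n : ℕ) :
    ContinuousOn (f lam n) (Metric.sphere 0 1) := by
  induction n using Nat.strong_induction_on with
  | _ n ih =>
    have h := f_rec lam n
    rw [show f lam n = _ from funext h]
    refine ContinuousOn.div (continuousOn_const.add (continuousOn_finsetSum _ fun l hl' => ?_))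
      (by unfold quad; fun_prop)
      fun z hz => quad_ne_zero_of_norm_eq_one hl n (by simpa using hz)
    exact ContinuousOn.mul (by fun_prop) (ih l (Finset.mem_range.1 hl'))

/-- This is `f_rec` multiplied by `Qₙ` and divided by `2 ^ (n + 1) z`; the part `-lam (z² + 1)` of
`Qₙ` has become the summand `l = n`. -/
theorem f_rec_laurent {lam : ℂ} (hl : ‖lam‖ < 1) (n : ℕ) {z : ℂ} (hz : ‖z‖ = 1) :
    f lam n z = (1 + (-1) ^ n) / (n + 1) * z⁻¹ + lam / 2 ^ (n + 1) *
      ∑ l ∈ Finset.range (n + 1), (n.choose l : ℂ) * (z * f lam l z +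
        (-1) ^ (n - l) * (z⁻¹ * f lam l z)) := by
  have h := f_rec lam n z
  have hq := quad_ne_zero_of_norm_eq_one hl n hz
  have hz0 : z ≠ 0 := by rintro rfl; simp at hz
  rw [eq_div_iff hq] at h
  have hsum : ∑ l ∈ Finset.range n, lam * (n.choose l) * (z ^ 2 + (-1) ^ (n - l)) * f lam l z =
      lam * z * ∑ l ∈ Finset.range n, (n.choose l : ℂ) * (z * f lam l z +
        (-1) ^ (n - l) * (z⁻¹ * f lam l z)) := by
    rw [Finset.mul_sum]
    exact Finset.sum_congr rfl fun l _ => by field_simp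
  rw [hsum, quad] at h
  rw [Finset.sum_range_succ]
  generalize ∑ l ∈ Finset.range n, (n.choose l : ℂ) * (z * f lam l z +
        (-1) ^ (n - l) * (z⁻¹ * f lam l z)) = s at *
  have h2 : (2 : ℂ) ^ (n + 1) ≠ 0 := pow_ne_zero _ two_ne_zero
  have h3 : (n : ℂ) + 1 ≠ 0 := Nat.cast_add_one_ne_zero n
  simp only [Nat.choose_self, Nat.sub_self, pow_zero, Nat.cast_one]
  field_simp at h ⊢
  linear_combination h

/-- The Laurent coefficients of `z fₙ(z)` on the unit circle. -/
noncomputable def laurentCoeff (lam : ℂ) (r : ℤ) (n : ℕ) : ℂ :=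
  (2 * (Real.pi : ℂ) * Complex.I)⁻¹ * ∮ z in C(0, 1), z ^ (-r) * f lam n z

/-- Multiplication by `z` or `z⁻¹` shifts the Laurent index by one, so `f_rec_laurent` is the moment
recursion in generating function form. Boundedness holds because `|z ^ (-r)| = 1` on the circle. -/
theorem isMomentFamily_laurentCoeff {lam : ℂ} (hl : ‖lam‖ < 1) :
    IsMomentFamily lam (laurentCoeff lam) := by
  have hz0 : ∀ z ∈ Metric.sphere (0 : ℂ) 1, z ≠ 0 := by
    rintro z hz rfl
    simp at hz
  have hpow : ∀ r : ℤ, ContinuousOn (fun z : ℂ => z ^ r) (Metric.sphere 0 1) := fun r =>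
    continuousOn_id.zpow₀ r fun z hz => Or.inl (hz0 z hz)
  constructor
  · intro n
    obtain ⟨C, hC⟩ := (isCompact_sphere (0 : ℂ) 1).exists_bound_of_continuousOn (continuousOn_f hl n)
    refine ⟨1 * C, fun r => ?_⟩
    refine circleIntegral.norm_two_pi_i_inv_smul_integral_le_of_norm_le_const zero_le_one
      fun z hz => ?_
    have h1 : ‖z‖ = 1 := by simpa using hz
    rw [norm_mul, norm_zpow, h1, one_zpow, one_mul]
    exact hC z hz
  · intro r n
    have hint : ∀ (k : ℤ) (l : ℕ), CircleIntegrable (fun z => z ^ k * f lam l z) 0 1 := fun k l =>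
      ContinuousOn.circleIntegrable zero_le_one ((hpow k).mul (continuousOn_f hl l))
    have hcongr : (∮ z in C(0, 1), z ^ (-r) * f lam n z) =
        ∮ z in C(0, 1), ((1 + (-1) ^ n) / (n + 1) * z ^ (-r - 1) + lam / 2 ^ (n + 1) *
          ∑ l ∈ Finset.range (n + 1), (n.choose l : ℂ) * (z ^ (-(r - 1)) * f lam l z +
            (-1) ^ (n - l) * (z ^ (-(r + 1)) * f lam l z))) := by
      refine circleIntegral.integral_congr zero_le_one fun z hz => ?_
      have hz' := hz0 z hz
      rw [f_rec_laurent hl n (by simpa using hz), mul_add, Finset.mul_sum, Finset.mul_sum,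
        Finset.mul_sum]
      congr 1
      · rw [zpow_sub_one₀ hz']; ring
      · refine Finset.sum_congr rfl fun l _ => ?_
        rw [show -(r - 1) = -r + 1 by ring, show -(r + 1) = -r - 1 by ring, zpow_add_one₀ hz',
          zpow_sub_one₀ hz']
        ring
    have hmono : (2 * (Real.pi : ℂ) * Complex.I)⁻¹ * (∮ z in C(0, 1), z ^ (-r - 1)) =
        if r = 0 then 1 else 0 := by
      split_ifs with h
      · have := circleIntegral.integral_sub_center_inv (0 : ℂ) (R := 1) one_ne_zero
        simp only [sub_zero] at this
        simp only [h, neg_zero, zero_sub, zpow_neg_one, this]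
        exact inv_mul_cancel₀ Complex.two_pi_I_ne_zero
      · have := circleIntegral.integral_sub_zpow_of_ne (n := -r - 1) (by omega) 0 0 1
        simp only [sub_zero] at this
        rw [this, mul_zero]
    have hsmul : ∀ (a : ℂ) {g : ℂ → ℂ}, CircleIntegrable g 0 1 →
        CircleIntegrable (fun z => a * g z) 0 1 := fun a _ hg => IntervalIntegrable.const_mul hg a
    have hint2 : ∀ l ∈ Finset.range (n + 1), CircleIntegrable (fun z =>
        (n.choose l : ℂ) * (z ^ (-(r - 1)) * f lam l z +
          (-1) ^ (n - l) * (z ^ (-(r + 1)) * f lam l z))) 0 1 := fun l _ =>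
      hsmul _ ((hint _ l).add (hsmul _ (hint _ l)))
    have hint3 : CircleIntegrable (fun z : ℂ => z ^ (-r - 1)) 0 1 :=
      (hpow _).circleIntegrable zero_le_one
    simp only [laurentCoeff]
    rw [hcongr, circleIntegral.integral_add (hsmul _ hint3), circleIntegral.integral_const_mul,
      circleIntegral.integral_const_mul, circleIntegral.integral_fun_sum hint2, mul_add,
      mul_left_comm, hmono]
    · congr 1
      · split_ifs <;> simp
      · rw [mul_left_comm, Finset.mul_sum]
        congr 1
        refine Finset.sum_congr rfl fun l _ => ?_
        rw [circleIntegral.integral_const_mul, circleIntegral.integral_add (hint _ l)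
          (hsmul _ (hint _ l)), circleIntegral.integral_const_mul]
        ring
    · exact hsmul _ (CircleIntegrable.fun_sum _ hint2)

/-! ### The explicit solution of the moment recursion

The bounded solution has the form `∑_{j ≤ A} c_{A,j} zⱼ ^ |r|` up to sign. -/

/-- The coefficient `c_{A,j}` for `j < A`, given the `c_{l,j}` with `l < A`. -/
noncomputable def offDiagCoeff (lam : ℂ) (A : ℕ) (c : Fin A → ℕ → ℂ) (j : ℕ) : ℂ :=
  (2 ^ j + Complex.sqrt (4 ^ j - lam ^ 2)) / (2 ^ (A + 1) - 2 ^ (j + 1)) *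
    ∑ l : Fin A, (A.choose l : ℂ) * c l j * (1 + (-1) ^ (A - l) * root lam j ^ 2)

/-- The coefficient `c_{A,A}`, given the `c_{l,j}` with `l < A`. -/
noncomputable def diagCoeff (lam : ℂ) (A : ℕ) (c : Fin A → ℕ → ℂ) : ℂ :=
  ((1 + (-1) ^ A) / ((A : ℂ) + 1)
    - ∑ j ∈ Finset.range A,
        offDiagCoeff lam A c j * (1 - lam / 2 ^ (A + 1) * (1 + (-1) ^ A) * root lam j)
    + lam / 2 ^ (A + 1) * (1 + (-1) ^ A) * ∑ l : Fin A, (A.choose l : ℂ) * (-1) ^ (l : ℕ) *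
        ∑ j ∈ Finset.range A, c l j * root lam j) /
    (1 - lam / 2 ^ (A + 1) * (1 + (-1) ^ A) * root lam A)

/-- The coefficients `c_{A,j}`. -/
noncomputable def coeff (lam : ℂ) (A j : ℕ) : ℂ :=
  if j < A then offDiagCoeff lam A (fun l k => coeff lam l k) j
  else if j = A then diagCoeff lam A (fun l k => coeff lam l k) else 0
termination_by A
decreasing_by all_goals exact l.2

theorem coeff_of_lt (lam : ℂ) {A j : ℕ} (h : j < A) :
    coeff lam A j = offDiagCoeff lam A (fun l k => coeff lam l k) j := by
  rw [coeff, if_pos h]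

theorem coeff_self (lam : ℂ) (A : ℕ) :
    coeff lam A A = diagCoeff lam A (fun l k => coeff lam l k) := by
  rw [coeff, if_neg (lt_irrefl A), if_pos rfl]

theorem coeff_of_gt (lam : ℂ) {A j : ℕ} (h : A < j) : coeff lam A j = 0 := by
  rw [coeff, if_neg h.not_gt, if_neg h.ne']

/-- The three factors subtracted from 1 have moduli at most `1 / 2`, at most 2, and less than 1. -/
theorem one_sub_ne_zero {lam : ℂ} (hl : ‖lam‖ < 1) (A : ℕ) :
    1 - lam / 2 ^ (A + 1) * (1 + (-1) ^ A) * root lam A ≠ 0 := by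
  intro h
  have h1 : ‖lam / 2 ^ (A + 1) * (1 + (-1) ^ A) * root lam A‖ = 1 := by
    rw [← sub_eq_zero.1 h, norm_one]
  have h2 : ‖(1 : ℂ) + (-1) ^ A‖ ≤ 2 := by
    refine (norm_add_le _ _).trans ?_
    simp
    norm_num
  have h3 : ‖lam / 2 ^ (A + 1)‖ ≤ 1 / 2 := by
    rw [norm_div, norm_pow, Complex.norm_ofNat, pow_succ]
    have : (1 : ℝ) ≤ 2 ^ A := one_le_pow₀ (by norm_num)
    gcongr
    linarith
  have h4 : ‖root lam A‖ < 1 := (norm_root_le lam A).trans_lt hl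
  rw [norm_mul, norm_mul] at h1
  have h5 : ‖lam / 2 ^ (A + 1)‖ * ‖(1 : ℂ) + (-1) ^ A‖ ≤ 1 / 2 * 2 := by gcongr
  nlinarith [norm_nonneg (root lam A)]

theorem two_pow_sub_ne_zero {j A : ℕ} (h : j < A) : (2 : ℂ) ^ (A + 1) - 2 ^ (j + 1) ≠ 0 := by
  rw [sub_ne_zero]
  intro h'
  have : (2 : ℕ) ^ (A + 1) = 2 ^ (j + 1) := by exact_mod_cast h'
  have := Nat.pow_right_injective le_rfl this
  omega

theorem root_mul (lam : ℂ) (j : ℕ) :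
    root lam j * (2 ^ j + Complex.sqrt (4 ^ j - lam ^ 2)) = lam :=
  div_mul_cancel₀ _ (two_pow_add_sqrt_ne_zero lam j)

/-- This is the recursion at `r > 0` compared termwise in `zⱼ`, with `lam (1 + zⱼ²) = 2 ^ (j + 1)
zⱼ` used for `l = A`. `offDiagCoeff` solves it with `2 ^ j + √(4 ^ j - lam²)` in place of `lam /
zⱼ`, which stays meaningful at `lam = 0`. For `j = A` both sides vanish, so `c_{A,A}` remains free
to satisfy the equation at `r = 0`. -/
theorem coeff_mul_root (lam : ℂ) {A j : ℕ} (h : j ≤ A) :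
    coeff lam A j * ((2 ^ (A + 1) - 2 ^ (j + 1)) * root lam j) =
      lam * ∑ l ∈ Finset.range A,
        (A.choose l : ℂ) * coeff lam l j * (1 + (-1) ^ (A - l) * root lam j ^ 2) := by
  rcases h.lt_or_eq with h | rfl
  · rw [coeff_of_lt lam h, offDiagCoeff, Fin.sum_univ_eq_sum_range
      (fun l => (A.choose l : ℂ) * coeff lam l j * (1 + (-1) ^ (A - l) * root lam j ^ 2))]
    have h2 := two_pow_sub_ne_zero h
    generalize ∑ l ∈ Finset.range A, (A.choose l : ℂ) * coeff lam l j *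
      (1 + (-1) ^ (A - l) * root lam j ^ 2) = s
    have hr := root_mul lam j
    field_simp
    linear_combination s * hr
  · rw [sub_self, zero_mul, mul_zero, Finset.sum_eq_zero, mul_zero]
    intro l hl
    rw [coeff_of_gt lam (Finset.mem_range.1 hl), mul_zero, zero_mul]

theorem sum_coeff_mul_one_sub {lam : ℂ} (hl : ‖lam‖ < 1) (A : ℕ) :
    ∑ j ∈ Finset.range (A + 1),
        coeff lam A j * (1 - lam / 2 ^ (A + 1) * (1 + (-1) ^ A) * root lam j) =
      (1 + (-1) ^ A) / ((A : ℂ) + 1) + lam / 2 ^ (A + 1) * (1 + (-1) ^ A) *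
        ∑ l ∈ Finset.range A, (A.choose l : ℂ) * (-1) ^ l *
          ∑ j ∈ Finset.range A, coeff lam l j * root lam j := by
  rw [Finset.sum_range_succ, coeff_self, diagCoeff, div_mul_cancel₀ _ (one_sub_ne_zero hl A),
    Fin.sum_univ_eq_sum_range (fun l => (A.choose l : ℂ) * (-1) ^ l *
          ∑ j ∈ Finset.range A, coeff lam l j * root lam j),
    Finset.sum_congr rfl fun j hj => by rw [coeff_of_lt lam (Finset.mem_range.1 hj)]]
  ring

/-- `∑_{j ≤ A} c_{A,j} zⱼ ^ k`. -/
noncomputable def powerSum (lam : ℂ) (A k : ℕ) : ℂ :=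
  ∑ j ∈ Finset.range (A + 1), coeff lam A j * root lam j ^ k

theorem powerSum_eq (lam : ℂ) {A N : ℕ} (h : A < N) (k : ℕ) :
    powerSum lam A k = ∑ j ∈ Finset.range N, coeff lam A j * root lam j ^ k := by
  refine Finset.sum_subset (Finset.range_subset_range.2 h) fun j _ hj => ?_
  rw [coeff_of_gt lam (by simpa using hj), zero_mul]

theorem powerSum_succ (lam : ℂ) (A k : ℕ) :
    powerSum lam A (k + 1) = lam / 2 ^ (A + 1) * ∑ l ∈ Finset.range (A + 1),
      (A.choose l : ℂ) * (powerSum lam l k + (-1) ^ (A - l) * powerSum lam l (k + 2)) := by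
  have h1 : ∑ l ∈ Finset.range (A + 1),
      (A.choose l : ℂ) * (powerSum lam l k + (-1) ^ (A - l) * powerSum lam l (k + 2)) =
      ∑ j ∈ Finset.range (A + 1), root lam j ^ k * ∑ l ∈ Finset.range (A + 1),
        (A.choose l : ℂ) * coeff lam l j * (1 + (-1) ^ (A - l) * root lam j ^ 2) := by
    simp only [Finset.mul_sum]
    rw [Finset.sum_comm]
    refine Finset.sum_congr rfl fun l hl => ?_
    rw [powerSum_eq lam (Finset.mem_range.1 hl), powerSum_eq lam (Finset.mem_range.1 hl),
      Finset.mul_sum, ← Finset.sum_add_distrib, Finset.mul_sum]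
    exact Finset.sum_congr rfl fun j _ => by ring
  rw [h1, powerSum, Finset.mul_sum]
  refine Finset.sum_congr rfl fun j hj => ?_
  have h2 := coeff_mul_root lam (Nat.lt_succ_iff.1 (Finset.mem_range.1 hj))
  have h3 := quad_root lam j
  rw [quad] at h3
  rw [Finset.sum_range_succ]
  generalize ∑ l ∈ Finset.range A, (A.choose l : ℂ) * coeff lam l j *
    (1 + (-1) ^ (A - l) * root lam j ^ 2) = s at *
  have h4 : (2 : ℂ) ^ (A + 1) ≠ 0 := pow_ne_zero _ two_ne_zero
  simp only [Nat.choose_self, Nat.sub_self, pow_zero, Nat.cast_one]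
  field_simp
  linear_combination root lam j ^ k * h2 + root lam j ^ k * coeff lam A j * h3

theorem neg_one_pow_add {A l : ℕ} (h : l ≤ A) :
    (-1 : ℂ) ^ l + (-1) ^ (A - l) = (-1) ^ l * (1 + (-1) ^ A) := by
  obtain ⟨m, rfl⟩ := Nat.exists_eq_add_of_le h
  have : ((-1 : ℂ) ^ l) * (-1) ^ l = 1 := by rw [← mul_pow]; simp
  rw [Nat.add_sub_cancel_left, pow_add]
  linear_combination -(-1) ^ m * this

/-- The recursion at `r = 0`, where the reflection `X_{-1}^l = (-1) ^ l X_1^l` has been inserted;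
`diagCoeff` was chosen to make it true. -/
theorem powerSum_zero {lam : ℂ} (hl : ‖lam‖ < 1) (A : ℕ) :
    powerSum lam A 0 = (1 + (-1) ^ A) / ((A : ℂ) + 1) + lam / 2 ^ (A + 1) *
      ∑ l ∈ Finset.range (A + 1),
        (A.choose l : ℂ) * (((-1) ^ l + (-1) ^ (A - l)) * powerSum lam l 1) := by
  have h := sum_coeff_mul_one_sub hl A
  have h1 : ∑ j ∈ Finset.range (A + 1),
      coeff lam A j * (1 - lam / 2 ^ (A + 1) * (1 + (-1) ^ A) * root lam j) =
      powerSum lam A 0 - lam / 2 ^ (A + 1) * (1 + (-1) ^ A) * powerSum lam A 1 := by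
    rw [powerSum, powerSum, Finset.mul_sum, ← Finset.sum_sub_distrib]
    exact Finset.sum_congr rfl fun j _ => by ring
  have h2 : ∑ l ∈ Finset.range A, (A.choose l : ℂ) * (((-1) ^ l + (-1) ^ (A - l)) *
      powerSum lam l 1) = (1 + (-1) ^ A) * ∑ l ∈ Finset.range A, (A.choose l : ℂ) * (-1) ^ l *
          ∑ j ∈ Finset.range A, coeff lam l j * root lam j := by
    rw [Finset.mul_sum]
    refine Finset.sum_congr rfl fun l hl => ?_
    rw [neg_one_pow_add (Finset.mem_range.1 hl).le, powerSum_eq lam (Finset.mem_range.1 hl)]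
    simp only [pow_one]
    ring
  rw [Finset.sum_range_succ, h2]
  simp only [Nat.choose_self, Nat.sub_self, pow_zero, Nat.cast_one]
  rw [h1] at h
  linear_combination h

/-- Makes the reflection rule `X_{-r}^A = (-1) ^ A X_r^A` consistent at `r = 0`. -/
theorem powerSum_zero_of_odd {lam : ℂ} (hl : ‖lam‖ < 1) {A : ℕ} (hA : Odd A) :
    powerSum lam A 0 = 0 := by
  rw [powerSum_zero hl, hA.neg_one_pow, Finset.sum_eq_zero]
  · simp
  · intro l hl
    rw [neg_one_pow_add (Nat.lt_succ_iff.1 (Finset.mem_range.1 hl)), hA.neg_one_pow]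
    simp

/-- The explicit solution of the moment recursion. -/
noncomputable def explicitMoment (lam : ℂ) (r : ℤ) (A : ℕ) : ℂ :=
  (if r < 0 then (-1) ^ A else 1) * powerSum lam A r.natAbs

theorem explicitMoment_natCast (lam : ℂ) (k A : ℕ) :
    explicitMoment lam k A = powerSum lam A k := by
  simp [explicitMoment]

theorem explicitMoment_neg_natCast {lam : ℂ} (hl : ‖lam‖ < 1) (k A : ℕ) :
    explicitMoment lam (-k) A = (-1) ^ A * powerSum lam A k := by
  rcases Nat.eq_zero_or_pos k with rfl | hk
  · rcases A.even_or_odd with hA | hA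
    · simp [explicitMoment, hA.neg_one_pow]
    · simp [explicitMoment, powerSum_zero_of_odd hl hA]
  · simp [explicitMoment, hk]

theorem isMomentFamily_explicitMoment {lam : ℂ} (hl : ‖lam‖ < 1) :
    IsMomentFamily lam (explicitMoment lam) := by
  constructor
  · intro A
    refine ⟨∑ j ∈ Finset.range (A + 1), ‖coeff lam A j‖, fun r => ?_⟩
    have h1 : ‖(if r < 0 then (-1) ^ A else 1 : ℂ)‖ = 1 := by split_ifs <;> simp
    rw [explicitMoment, norm_mul, h1, one_mul]
    refine (norm_sum_le _ _).trans (Finset.sum_le_sum fun j _ => ?_)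
    rw [norm_mul, norm_pow]
    exact mul_le_of_le_one_right (norm_nonneg _)
      (pow_le_one₀ (norm_nonneg _) ((norm_root_le lam j).trans hl.le))
  · intro r A
    rcases lt_trichotomy r 0 with hr | rfl | hr
    · obtain ⟨k, rfl⟩ : ∃ k : ℕ, r = -((k + 1 : ℕ) : ℤ) := ⟨(-r - 1).toNat, by omega⟩
      rw [if_neg hr.ne, zero_add, explicitMoment_neg_natCast hl, powerSum_succ,
        mul_left_comm, Finset.mul_sum]
      congr 1
      refine Finset.sum_congr rfl fun l hl' => ?_
      rw [show -((k + 1 : ℕ) : ℤ) - 1 = -((k + 2 : ℕ) : ℤ) by push_cast; ring,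
        show -((k + 1 : ℕ) : ℤ) + 1 = -(k : ℤ) by push_cast; ring,
        explicitMoment_neg_natCast hl, explicitMoment_neg_natCast hl]
      obtain ⟨m, rfl⟩ := Nat.exists_eq_add_of_le (Nat.lt_succ_iff.1 (Finset.mem_range.1 hl'))
      have : ((-1 : ℂ) ^ m) * (-1) ^ m = 1 := by rw [← mul_pow]; simp
      rw [Nat.add_sub_cancel_left, pow_add]
      linear_combination ((l + m).choose l : ℂ) * (-1) ^ l * powerSum lam l (k + 2) * this
    · rw [if_pos rfl]
      have h := powerSum_zero hl A
      rw [show (0 : ℤ) = ((0 : ℕ) : ℤ) by rfl, explicitMoment_natCast, h]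
      congr 2
      refine Finset.sum_congr rfl fun l _ => ?_
      rw [show ((0 : ℕ) : ℤ) - 1 = -((1 : ℕ) : ℤ) by rfl,
        show ((0 : ℕ) : ℤ) + 1 = ((1 : ℕ) : ℤ) by rfl, explicitMoment_natCast,
        explicitMoment_neg_natCast hl]
      ring
    · obtain ⟨k, rfl⟩ : ∃ k : ℕ, r = ((k + 1 : ℕ) : ℤ) := ⟨(r - 1).toNat, by omega⟩
      rw [if_neg hr.ne', zero_add, explicitMoment_natCast, powerSum_succ]
      congr 1
      refine Finset.sum_congr rfl fun l _ => ?_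
      rw [show ((k + 1 : ℕ) : ℤ) - 1 = (k : ℤ) by push_cast; ring,
        show ((k + 1 : ℕ) : ℤ) + 1 = ((k + 2 : ℕ) : ℤ) by push_cast; ring,
        explicitMoment_natCast, explicitMoment_natCast]

/-! ### Closed forms of the explicit solution -/

theorem hasClosedForm_coeff (A j : ℕ) : HasClosedForm A (fun lam => coeff lam A j) := by
  induction A using Nat.strong_induction_on generalizing j with
  | _ A ih =>
    have hc : ∀ (l : Fin A) (k : ℕ), HasClosedForm A (fun lam => coeff lam l k) := fun l k =>
      (ih l l.2 k).mono l.2.le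
    have hsign : ∀ k : ℕ, HasClosedForm A (fun _ => (-1) ^ k) := fun k =>
      .const ((-1) ^ k) (by simp)
    have hone : HasClosedForm A (fun _ => 1) := .const 1 (by simp)
    have hoff : ∀ k < A, HasClosedForm A
        (fun lam => offDiagCoeff lam A (fun l k => coeff lam l k) k) := fun k hk => by
      refine .mul (.div (.add (.const (2 ^ k) (by simp)) (.sqrt hk.le))
        (.const (2 ^ (A + 1) - 2 ^ (k + 1)) (by push_cast; rfl))
        fun _ _ => two_pow_sub_ne_zero hk) ?_
      exact .sum _ fun l _ => .mul (.mul (.natCast _) (hc l k))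
        (hone.add ((hsign _).mul ((hasClosedForm_root hk.le).pow 2)))
    have hfac : HasClosedForm A (fun lam => lam / 2 ^ (A + 1) * (1 + (-1) ^ A)) :=
      .mul (.div .param (.const (2 ^ (A + 1)) (by simp)) fun _ _ => pow_ne_zero _ two_ne_zero)
        (hone.add (hsign A))
    rcases lt_trichotomy j A with h | rfl | h
    · exact (hoff j h).congr fun lam _ => coeff_of_lt lam h
    · refine HasClosedForm.congr ?_ fun lam _ => coeff_self lam j
      refine .div (.add (.sub (.const ((1 + (-1) ^ j) / (j + 1)) (by push_cast; rfl))
        (.sum _ fun k hk => ?_)) (.mul hfac (.sum _ fun l _ => .mul (.mul (.natCast _) (hsign _))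
          (.sum _ fun k hk => .mul (hc l k) (hasClosedForm_root (Finset.mem_range.1 hk).le)))))
        (.sub hone (hfac.mul (hasClosedForm_root le_rfl))) fun lam hl => one_sub_ne_zero hl j
      have hk := Finset.mem_range.1 hk
      exact (hoff k hk).mul (.sub hone (hfac.mul (hasClosedForm_root hk.le)))
    · exact HasClosedForm.congr (.const 0 (by simp)) fun lam _ => coeff_of_gt lam h

theorem hasClosedForm_explicitMoment (r : ℤ) (A : ℕ) :
    HasClosedForm A (fun lam => explicitMoment lam r A) := by
  refine .mul ?_ (.sum _ fun j hj => .mul (hasClosedForm_coeff A j)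
    (.pow (hasClosedForm_root (Nat.lt_succ_iff.1 (Finset.mem_range.1 hj))) _))
  split_ifs
  · exact .const ((-1) ^ A) (by simp)
  · exact .const 1 (by simp)

/-! ### The sums of residues -/

theorem fHat_eq_laurentCoeff {lam : ℂ} (hl : ‖lam‖ < 1) (n : ℕ) :
    fHat lam n = laurentCoeff lam 0 n := by
  rw [fHat_eq_circleIntegral hl, laurentCoeff]
  simp

theorem hasClosedForm_fHat (n : ℕ) : HasClosedForm n (fun lam => fHat lam n) :=
  (hasClosedForm_explicitMoment 0 n).congr fun _ hl => (fHat_eq_laurentCoeff hl n).trans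
    ((isMomentFamily_laurentCoeff hl).unique hl (isMomentFamily_explicitMoment hl) 0 n)

/-! ### The generating functions of the visits -/

/-- `W_r(x) = ∑ₖ lam ^ k [x₀ + ⋯ + xₖ₋₁ = r]`. -/
noncomputable def visits (lam : ℂ) (r : ℤ) (x : ℝ) : ℂ :=
  ∑' k : ℕ, lam ^ k * if ∑ j ∈ Finset.range k, digit x j = r then 1 else 0

theorem digit_succ (x : ℝ) (n : ℕ) : digit x (n + 1) = digit (shift x) n := by
  rw [digit, digit, Function.iterate_succ_apply]

theorem norm_visits_term_le (lam : ℂ) (r : ℤ) (x : ℝ) (k : ℕ) :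
    ‖lam ^ k * if ∑ j ∈ Finset.range k, digit x j = r then 1 else 0‖ ≤ ‖lam‖ ^ k := by
  rw [norm_mul, norm_pow]
  refine mul_le_of_le_one_right (by positivity) ?_
  split_ifs <;> simp

theorem summable_visits {lam : ℂ} (hl : ‖lam‖ < 1) (r : ℤ) (x : ℝ) :
    Summable fun k : ℕ => lam ^ k * if ∑ j ∈ Finset.range k, digit x j = r then (1 : ℂ) else 0 :=
  .of_norm_bounded (summable_geometric_of_lt_one (norm_nonneg _) hl)
    (norm_visits_term_le lam r x)

theorem norm_visits_le {lam : ℂ} (hl : ‖lam‖ < 1) (r : ℤ) (x : ℝ) :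
    ‖visits lam r x‖ ≤ (1 - ‖lam‖)⁻¹ :=
  tsum_of_norm_bounded (hasSum_geometric_of_lt_one (norm_nonneg _) hl)
    (norm_visits_term_le lam r x)

/-- The term `k = 0` is `[r = 0]`; in the others the first step is removed and the target moves to
`r - x₀`. -/
theorem visits_eq {lam : ℂ} (hl : ‖lam‖ < 1) (r : ℤ) (x : ℝ) :
    visits lam r x = (if r = 0 then 1 else 0) + lam * visits lam (r - digit x 0) (shift x) := by
  rw [visits, (summable_visits hl r x).tsum_eq_zero_add, visits, ← tsum_mul_left]
  congr 1
  · simp [eq_comm]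
  · refine tsum_congr fun k => ?_
    simp only [Finset.sum_range_succ', digit_succ, ← eq_sub_iff_add_eq]
    ring

theorem loopInd_succ (n m : ℕ) (x : ℝ) : loopInd (n + 1) (m + 1) x = loopInd n m (shift x) := by
  simp only [loopInd, ← Finset.map_add_right_Icc, Finset.sum_map, addRightEmbedding_apply,
    digit_succ]

theorem summable_U {lam : ℂ} (hl : ‖lam‖ < 1) (x : ℝ) :
    Summable fun m : ℕ => ∑ n ∈ Finset.range (m + 1), lam ^ (m + 1) * loopInd n m x :=
  .of_norm_bounded (summable_loop hl x) fun _ => norm_sum_le _ _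

/-- Loops starting at `n = 0` are the returns counted by `W_0`, without the empty walk `k = 0`;
loops with `n ≥ 1` are the loops of `shift x`. -/
theorem U_eq {lam : ℂ} (hl : ‖lam‖ < 1) (x : ℝ) :
    U lam x = visits lam 0 x - 1 + lam * U lam (shift x) := by
  have h0 : HasSum (fun m : ℕ => lam ^ (m + 1) * loopInd 0 m x) (visits lam 0 x - 1) := by
    have h := (hasSum_nat_add_iff' 1).2 (summable_visits hl 0 x).hasSum
    simp only [Finset.sum_range_one, Finset.sum_range_zero, pow_zero, if_true, mul_one] at h
    refine h.congr_fun fun m => ?_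
    rw [loopInd, Nat.range_succ_eq_Icc_zero]
  have h1 : HasSum (fun m : ℕ => ∑ n ∈ Finset.range m, lam ^ (m + 1) * loopInd (n + 1) m x)
      (lam * U lam (shift x)) := by
    have h := (summable_U hl (shift x)).hasSum.mul_left lam
    rw [← hasSum_nat_add_iff' 1]
    simp only [Finset.sum_range_one, Finset.sum_range_zero, sub_zero]
    refine h.congr_fun fun m => ?_
    rw [Finset.mul_sum]
    exact Finset.sum_congr rfl fun n _ => by rw [loopInd_succ]; ring
  refine (h0.add h1).tsum_eq.symm ▸ tsum_congr fun m => ?_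
  rw [Finset.sum_range_succ', add_comm]

theorem exists_norm_U_le {lam : ℂ} (hl : ‖lam‖ < 1) : ∃ C, ∀ x, ‖U lam x‖ ≤ C := by
  have h1 : Summable (fun m : ℕ => ((m + 1 : ℕ) : ℝ) * ‖lam‖ ^ (m + 1)) := by
    have := summable_pow_mul_geometric_of_norm_lt_one 1 (r := ‖lam‖) (by simpa using hl)
    simpa using (summable_nat_add_iff 1).2 this
  refine ⟨_, fun x => tsum_of_norm_bounded h1.hasSum fun m => ?_⟩
  refine (norm_sum_le _ _).trans ((Finset.sum_le_card_nsmul _ _ (‖lam‖ ^ (m + 1))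
    fun n _ => ?_).trans (by simp))
  rw [norm_mul, norm_pow]
  refine mul_le_of_le_one_right (by positivity) ?_
  unfold loopInd
  split_ifs <;> simp

theorem measurable_shift : Measurable shift :=
  Measurable.ite measurableSet_Ici (by fun_prop) (by fun_prop)

theorem measurable_digit (n : ℕ) : Measurable fun x => digit x n :=
  Measurable.ite (measurable_shift.iterate n measurableSet_Ici) measurable_const measurable_const

theorem measurable_tsum {g : ℕ → ℝ → ℂ} (hg : ∀ n, Measurable (g n))
    (hs : ∀ x, Summable fun n => g n x) : Measurable fun x => ∑' n, g n x :=
  measurable_of_tendsto_metrizable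
    (fun N => Finset.measurable_fun_sum (Finset.range N) fun n _ => hg n)
    (tendsto_pi_nhds.2 fun x => (hs x).hasSum.tendsto_sum_nat)

theorem measurable_visits {lam : ℂ} (hl : ‖lam‖ < 1) (r : ℤ) : Measurable (visits lam r) := by
  refine measurable_tsum (fun k => ?_) (summable_visits hl r)
  refine measurable_const.mul (Measurable.ite ?_ measurable_const measurable_const)
  exact (Finset.measurable_fun_sum (Finset.range k) fun n _ => measurable_digit n)
    (measurableSet_singleton r)

theorem measurable_U {lam : ℂ} (hl : ‖lam‖ < 1) : Measurable (U lam) := by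
  refine measurable_tsum (fun k => ?_) (summable_U hl)
  refine Finset.measurable_fun_sum _ fun n _ => measurable_const.mul ?_
  refine Measurable.ite ?_ measurable_const measurable_const
  exact (Finset.measurable_fun_sum (Finset.Icc n k) fun n _ => measurable_digit n)
    (measurableSet_singleton 0)

theorem intervalIntegrable_pow_mul {Φ : ℝ → ℂ} (hm : Measurable Φ) (hb : ∃ C, ∀ x, ‖Φ x‖ ≤ C)
    (A : ℕ) (a b : ℝ) : IntervalIntegrable (fun x : ℝ => (x : ℂ) ^ A * Φ x) volume a b := by
  obtain ⟨C, hC⟩ := hb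
  have h : IntervalIntegrable Φ volume a b := by
    rw [intervalIntegrable_iff]
    exact Measure.integrableOn_of_bounded (by simp) hm.aestronglyMeasurable
      (Filter.Eventually.of_forall hC)
  exact h.continuousOn_mul (by fun_prop)

theorem intervalIntegrable_visits {lam : ℂ} (hl : ‖lam‖ < 1) (r : ℤ) (A : ℕ) (a b : ℝ) :
    IntervalIntegrable (fun x : ℝ => (x : ℂ) ^ A * visits lam r x) volume a b :=
  intervalIntegrable_pow_mul (measurable_visits hl r) ⟨_, norm_visits_le hl r⟩ A a b

theorem intervalIntegrable_U {lam : ℂ} (hl : ‖lam‖ < 1) (A : ℕ) (a b : ℝ) :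
    IntervalIntegrable (fun x : ℝ => (x : ℂ) ^ A * U lam x) volume a b :=
  intervalIntegrable_pow_mul (measurable_U hl) (exists_norm_U_le hl) A a b

/-! ### Self-similarity of the integrals -/

/-- Substitution `x = (y + s) / 2` and the binomial theorem. -/
theorem integral_pow_mul_comp {Φ : ℝ → ℂ} (hm : Measurable Φ) (hb : ∃ C, ∀ x, ‖Φ x‖ ≤ C)
    (A : ℕ) (s : ℤ) (a b : ℝ) :
    ∫ x in a..b, (x : ℂ) ^ A * Φ (2 * x - s) =
      1 / 2 ^ (A + 1) * ∑ l ∈ Finset.range (A + 1), (A.choose l : ℂ) * (s : ℂ) ^ (A - l) *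
        ∫ y in (2 * a - s)..(2 * b - s), (y : ℂ) ^ l * Φ y := by
  have h1 : ∫ x in a..b, (x : ℂ) ^ A * Φ (2 * x - s) =
      ∫ x in a..b, (fun y : ℝ => (((y : ℂ) + s) / 2) ^ A * Φ y) (2 * x - s) := by
    refine intervalIntegral.integral_congr fun x _ => ?_
    simp only
    congr 2
    push_cast
    ring
  have h2 : ∀ y : ℝ, (((y : ℂ) + s) / 2) ^ A * Φ y = 1 / 2 ^ A *
      ∑ l ∈ Finset.range (A + 1), (A.choose l : ℂ) * (s : ℂ) ^ (A - l) * ((y : ℂ) ^ l * Φ y) := by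
    intro y
    rw [div_pow, add_pow, div_mul_eq_mul_div, Finset.sum_mul, one_div_mul_eq_div]
    congr 1
    exact Finset.sum_congr rfl fun l _ => by ring
  rw [h1, intervalIntegral.integral_comp_mul_sub
    (fun y : ℝ => (((y : ℂ) + s) / 2) ^ A * Φ y) (two_ne_zero (α := ℝ))]
  simp only [h2]
  rw [intervalIntegral.integral_const_mul, intervalIntegral.integral_finsetSum]
  · simp only [intervalIntegral.integral_const_mul, Complex.real_smul]
    push_cast
    rw [pow_succ]
    ring
  · exact fun l _ => (intervalIntegrable_pow_mul hm hb l _ _).const_mul _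

/-- The points strictly between `a` and `b` have first digit `s`. -/
def SameFirstDigit (s : ℤ) (a b : ℝ) : Prop := (s = 1 ∧ 0 ≤ a) ∨ (s = -1 ∧ b ≤ 0)

theorem SameFirstDigit.digit_shift {s : ℤ} {a b x : ℝ} (h : SameFirstDigit s a b)
    (hx : x ∈ Set.Ioo a b) : digit x 0 = s ∧ shift x = 2 * x - s := by
  rcases h with ⟨rfl, h⟩ | ⟨rfl, h⟩
  · have h0 : 0 ≤ x := h.trans hx.1.le
    simp [digit, shift, h0]
  · have h0 : ¬ 0 ≤ x := (hx.2.trans_le h).not_ge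
    simp [digit, shift, h0]

theorem integral_pow_visits {lam : ℂ} (hl : ‖lam‖ < 1) {s : ℤ} {a b : ℝ} (hab : a ≤ b)
    (h : SameFirstDigit s a b) (r : ℤ) (A : ℕ) :
    ∫ x in a..b, (x : ℂ) ^ A * visits lam r x =
      (if r = 0 then ∫ x in a..b, (x : ℂ) ^ A else 0) + lam / 2 ^ (A + 1) *
        ∑ l ∈ Finset.range (A + 1), (A.choose l : ℂ) * (s : ℂ) ^ (A - l) *
          ∫ y in (2 * a - s)..(2 * b - s), (y : ℂ) ^ l * visits lam (r - s) y := by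
  have hm : Measurable fun x : ℝ => lam * visits lam (r - s) x :=
    measurable_const.mul (measurable_visits hl _)
  have hb : ∃ C, ∀ x : ℝ, ‖lam * visits lam (r - s) x‖ ≤ C := ⟨‖lam‖ * (1 - ‖lam‖)⁻¹, fun x => by
    rw [norm_mul]
    gcongr
    exact norm_visits_le hl _ x⟩
  have h1 : ∫ x in a..b, (x : ℂ) ^ A * visits lam r x = ∫ x in a..b, ((x : ℂ) ^ A *
      (if r = 0 then 1 else 0) + (x : ℂ) ^ A * (lam * visits lam (r - s) (2 * x - s))) := by
    -- The endpoints must be excluded: for `s = -1` and `b = 0` the greedy first digit of `b` is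
    -- `+1`.
    refine intervalIntegral.integral_congr_Ioo_of_le hab fun x hx => ?_
    obtain ⟨hd, hs⟩ := h.digit_shift hx
    rw [visits_eq hl, hd, hs, mul_add]
  rw [h1, intervalIntegral.integral_add, integral_pow_mul_comp hm hb]
  · congr 1
    · split_ifs <;> simp
    · simp only [mul_left_comm _ lam, intervalIntegral.integral_const_mul]
      rw [← Finset.mul_sum]
      ring
  · exact Continuous.intervalIntegrable (by fun_prop) _ _
  · refine intervalIntegrable_pow_mul (Φ := fun x => lam * visits lam (r - s) (2 * x - s))
      (hm.comp (by fun_prop)) ?_ A a b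
    obtain ⟨C, hC⟩ := hb
    exact ⟨C, fun x => hC _⟩

theorem integral_pow_U {lam : ℂ} (hl : ‖lam‖ < 1) {s : ℤ} {a b : ℝ} (hab : a ≤ b)
    (h : SameFirstDigit s a b) (A : ℕ) :
    ∫ x in a..b, (x : ℂ) ^ A * U lam x =
      (∫ x in a..b, (x : ℂ) ^ A * visits lam 0 x) - (∫ x in a..b, (x : ℂ) ^ A) +
        lam / 2 ^ (A + 1) * ∑ l ∈ Finset.range (A + 1), (A.choose l : ℂ) * (s : ℂ) ^ (A - l) *
          ∫ y in (2 * a - s)..(2 * b - s), (y : ℂ) ^ l * U lam y := by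
  have hm : Measurable fun x : ℝ => lam * U lam x := measurable_const.mul (measurable_U hl)
  have hb : ∃ C, ∀ x : ℝ, ‖lam * U lam x‖ ≤ C := by
    obtain ⟨C, hC⟩ := exists_norm_U_le hl
    refine ⟨‖lam‖ * C, fun x => ?_⟩
    rw [norm_mul]
    gcongr
    exact hC x
  have hpow : IntervalIntegrable (fun x : ℝ => (x : ℂ) ^ A) volume a b :=
    Continuous.intervalIntegrable (by fun_prop) _ _
  have h1 : ∫ x in a..b, (x : ℂ) ^ A * U lam x = ∫ x in a..b, (((x : ℂ) ^ A * visits lam 0 x -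
      (x : ℂ) ^ A) + (x : ℂ) ^ A * (lam * U lam (2 * x - s))) := by
    refine intervalIntegral.integral_congr_Ioo_of_le hab fun x hx => ?_
    obtain ⟨-, hs⟩ := h.digit_shift hx
    rw [U_eq hl, hs]
    ring
  rw [h1, intervalIntegral.integral_add ((intervalIntegrable_visits hl 0 A a b).sub hpow),
    intervalIntegral.integral_sub (intervalIntegrable_visits hl 0 A a b) hpow,
    integral_pow_mul_comp hm hb]
  · congr 1
    simp only [mul_left_comm _ lam, intervalIntegral.integral_const_mul]
    rw [← Finset.mul_sum]
    ring
  · refine intervalIntegrable_pow_mul (Φ := fun x => lam * U lam (2 * x - s))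
      (hm.comp (by fun_prop)) ?_ A a b
    obtain ⟨C, hC⟩ := hb
    exact ⟨C, fun x => hC _⟩

/-! ### Integrals over `[-1, 1]` -/

theorem integral_pow (A : ℕ) (a b : ℝ) :
    ∫ x in a..b, (x : ℂ) ^ A = ((b : ℂ) ^ (A + 1) - (a : ℂ) ^ (A + 1)) / (A + 1) := by
  have h := _root_.integral_pow (a := a) (b := b) A
  have h2 : ∫ x in a..b, (x : ℂ) ^ A = ((∫ x in a..b, x ^ A : ℝ) : ℂ) := by
    rw [← intervalIntegral.integral_ofReal]
    push_cast
    rfl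
  rw [h2, h]
  push_cast
  rfl

theorem integral_pow_neg_one_one (A : ℕ) :
    ∫ x in (-1 : ℝ)..1, (x : ℂ) ^ A = (1 + (-1) ^ A) / (A + 1) := by
  rw [integral_pow]
  push_cast
  ring

theorem sameFirstDigit_left : SameFirstDigit (-1) (-1) 0 := Or.inr ⟨rfl, le_rfl⟩

theorem sameFirstDigit_right : SameFirstDigit 1 0 1 := Or.inl ⟨rfl, le_rfl⟩

/-- The left half, with `s = -1`, supplies the terms in `r + 1` with their signs, the right half
those in `r - 1`. -/
theorem isMomentFamily_integral {lam : ℂ} (hl : ‖lam‖ < 1) :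
    IsMomentFamily lam fun r A => ∫ x in (-1 : ℝ)..1, (x : ℂ) ^ A * visits lam r x := by
  constructor
  · intro A
    refine ⟨(1 - ‖lam‖)⁻¹ * |1 - -1|, fun r => ?_⟩
    refine intervalIntegral.norm_integral_le_of_norm_le_const fun x hx => ?_
    rw [Set.uIoc_of_le (by norm_num)] at hx
    rw [norm_mul, norm_pow, Complex.norm_real]
    refine (mul_le_of_le_one_left (norm_nonneg _) (pow_le_one₀ (norm_nonneg _) ?_)).trans
      (norm_visits_le hl r x)
    exact abs_le.2 ⟨hx.1.le, hx.2⟩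
  · intro r A
    have hsplit := intervalIntegral.integral_add_adjacent_intervals
      (intervalIntegrable_visits hl r A (-1) 0) (intervalIntegrable_visits hl r A 0 1)
    have hsplit' : (∫ x in (-1 : ℝ)..0, (x : ℂ) ^ A) + (∫ x in (0 : ℝ)..1, (x : ℂ) ^ A) =
        (1 + (-1) ^ A) / (A + 1) := by
      rw [← integral_pow_neg_one_one]
      exact intervalIntegral.integral_add_adjacent_intervals
        (Continuous.intervalIntegrable (by fun_prop) _ _)
        (Continuous.intervalIntegrable (by fun_prop) _ _)
    rw [integral_pow_visits hl (by norm_num) sameFirstDigit_left,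
      integral_pow_visits hl zero_le_one sameFirstDigit_right] at hsplit
    norm_num only [Int.cast_neg, Int.cast_one, sub_neg_eq_add] at hsplit
    rw [← hsplit, ← hsplit']
    simp only [mul_add, Finset.sum_add_distrib]
    have h1 : ∀ n : ℕ, ((1 : ℤ) : ℂ) ^ n = 1 := fun n => by simp
    split_ifs <;> simp <;> ring_nf

theorem integral_visits_zero {lam : ℂ} (hl : ‖lam‖ < 1) (A : ℕ) :
    ∫ x in (-1 : ℝ)..1, (x : ℂ) ^ A * visits lam 0 x = fHat lam A := by
  rw [fHat_eq_laurentCoeff hl]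
  exact (isMomentFamily_integral hl).unique hl (isMomentFamily_laurentCoeff hl) 0 A

theorem two_pow_sub_param_ne_zero {lam : ℂ} (hl : ‖lam‖ < 1) (A : ℕ) : (2 : ℂ) ^ A - lam ≠ 0 := by
  intro h
  have h1 : ‖lam‖ = 2 ^ A := by rw [← sub_eq_zero.1 h]; simp
  have : (1 : ℝ) ≤ 2 ^ A := one_le_pow₀ (by norm_num)
  linarith

theorem integral_U_rec {lam : ℂ} (hl : ‖lam‖ < 1) (A : ℕ) :
    ∫ x in (-1 : ℝ)..1, (x : ℂ) ^ A * U lam x =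
      2 ^ A * ((A + 1) * fHat lam A - 1 - (-1) ^ A) / ((A + 1) * (2 ^ A - lam)) +
        ∑ l ∈ Finset.range A,
          lam * (A.choose l) * (1 + (-1) ^ (A - l)) / (2 ^ (A + 1) - 2 * lam) *
            ∫ x in (-1 : ℝ)..1, (x : ℂ) ^ l * U lam x := by
  have hsplit := intervalIntegral.integral_add_adjacent_intervals
    (intervalIntegrable_U hl A (-1) 0) (intervalIntegrable_U hl A 0 1)
  have hsplit' := intervalIntegral.integral_add_adjacent_intervals
    (intervalIntegrable_visits hl 0 A (-1) 0) (intervalIntegrable_visits hl 0 A 0 1)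
  have hsplit'' : (∫ x in (-1 : ℝ)..0, (x : ℂ) ^ A) + (∫ x in (0 : ℝ)..1, (x : ℂ) ^ A) =
      (1 + (-1) ^ A) / (A + 1) := by
    rw [← integral_pow_neg_one_one]
    exact intervalIntegral.integral_add_adjacent_intervals
      (Continuous.intervalIntegrable (by fun_prop) _ _)
      (Continuous.intervalIntegrable (by fun_prop) _ _)
  rw [integral_visits_zero hl] at hsplit'
  rw [integral_pow_U hl (by norm_num) sameFirstDigit_left,
    integral_pow_U hl zero_le_one sameFirstDigit_right] at hsplit
  norm_num only [Int.cast_neg, Int.cast_one, sub_neg_eq_add] at hsplit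
  have hsum : ∀ M : ℕ → ℂ, ∑ l ∈ Finset.range A,
      lam * (A.choose l) * (1 + (-1) ^ (A - l)) / (2 ^ (A + 1) - 2 * lam) * M l =
      lam / (2 ^ (A + 1) - 2 * lam) * (∑ l ∈ Finset.range A, (A.choose l : ℂ) * (-1) ^ (A - l) * M l
        + ∑ l ∈ Finset.range A, (A.choose l : ℂ) * 1 ^ (A - l) * M l) := by
    intro M
    rw [← Finset.sum_add_distrib, Finset.mul_sum]
    exact Finset.sum_congr rfl fun l _ => by rw [one_pow]; ring
  rw [hsum]
  rw [Finset.sum_range_succ, Finset.sum_range_succ] at hsplit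
  simp only [Nat.choose_self, Nat.sub_self, pow_zero, Nat.cast_one, one_mul] at hsplit
  generalize (∑ l ∈ Finset.range A, (A.choose l : ℂ) * (-1) ^ (A - l) *
    ∫ x in (-1 : ℝ)..1, (x : ℂ) ^ l * U lam x) = s at *
  generalize (∑ l ∈ Finset.range A, (A.choose l : ℂ) * 1 ^ (A - l) *
    ∫ x in (-1 : ℝ)..1, (x : ℂ) ^ l * U lam x) = t at *
  generalize ∫ x in (-1 : ℝ)..1, (x : ℂ) ^ A * U lam x = M at *
  have h1 : (2 : ℂ) ^ A ≠ 0 := pow_ne_zero _ two_ne_zero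
  have h2 := two_pow_sub_param_ne_zero hl A
  have h3 : (A : ℂ) + 1 ≠ 0 := Nat.cast_add_one_ne_zero A
  -- Each half contributes the unknown `M` itself through its summand `l = A`; solving for `M`
  -- produces the denominator `2 ^ A - lam`.
  have h4 : M = fHat lam A - (1 + (-1) ^ A) / (A + 1) + lam / 2 ^ (A + 1) * (s + t + 2 * M) := by
    rw [← hsplit', ← hsplit'']
    linear_combination -hsplit
  have h5 : (2 : ℂ) ^ (A + 1) - 2 * lam = 2 * (2 ^ A - lam) := by ring
  rw [h5]
  rw [pow_succ] at h4
  field_simp at h4 ⊢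
  linear_combination h4

theorem integral_U_eq_chainSum {lam : ℂ} (hl : ‖lam‖ < 1) (A : ℕ) :
    ∫ x in (-1 : ℝ)..1, (x : ℂ) ^ A * U lam x =
      chainSum (fun n => 2 ^ n * ((n + 1) * fHat lam n - 1 - (-1) ^ n) /
          ((n + 1) * (2 ^ n - lam)))
        (fun k l => lam * (k.choose l) * (1 + (-1) ^ (k - l)) / (2 ^ (k + 1) - 2 * lam)) A :=
  eq_chainSum _ _ (a := fun A => ∫ x in (-1 : ℝ)..1, (x : ℂ) ^ A * U lam x) (integral_U_rec hl) A

/-! ### Integrals over dyadic intervals -/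

/-- The moments over `[a, b]` of the functions `W_r` and `U` have closed forms. -/
def HasClosedMoments (a b : ℚ) : Prop :=
  ∀ A : ℕ, (∀ r : ℤ, HasClosedForm A fun lam =>
      ∫ x in (a : ℝ)..(b : ℝ), (x : ℂ) ^ A * visits lam r x) ∧
    HasClosedForm A fun lam => ∫ x in (a : ℝ)..(b : ℝ), (x : ℂ) ^ A * U lam x

theorem hasClosedMoments_neg_one_one : HasClosedMoments (-1) 1 := by
  intro A
  simp only [Rat.cast_neg, Rat.cast_one]
  refine ⟨fun r => (hasClosedForm_explicitMoment r A).congr fun lam hl =>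
    (isMomentFamily_integral hl).unique hl (isMomentFamily_explicitMoment hl) r A, ?_⟩
  induction A using Nat.strong_induction_on with
  | _ A ih =>
    refine HasClosedForm.congr ?_ fun lam hl => integral_U_rec hl A
    refine .add (.div ?_ ?_ ?_) (.sum _ fun l hl => .mul (.div ?_ ?_ ?_) ?_)
    · exact .mul (.const (2 ^ A) (by simp)) (.sub (.sub (.mul (.const (A + 1) (by simp))
        (hasClosedForm_fHat A)) (.const 1 (by simp))) (.const ((-1) ^ A) (by simp)))
    · exact .mul (.const (A + 1) (by simp)) (.sub (.const (2 ^ A) (by simp)) .param)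
    · exact fun lam hl => mul_ne_zero (Nat.cast_add_one_ne_zero A) (two_pow_sub_param_ne_zero hl A)
    · exact .mul (.mul .param (.natCast _)) (.const (1 + (-1) ^ (A - l)) (by simp))
    · exact .sub (.const (2 ^ (A + 1)) (by simp)) (.mul (.const 2 (by simp)) .param)
    · intro lam hl
      rw [show (2 : ℂ) ^ (A + 1) - 2 * lam = 2 * (2 ^ A - lam) by ring]
      exact mul_ne_zero two_ne_zero (two_pow_sub_param_ne_zero hl A)
    · exact (ih l (Finset.mem_range.1 hl)).mono (Finset.mem_range.1 hl).le

theorem hasClosedForm_integral_pow (A : ℕ) (a b : ℚ) :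
    HasClosedForm A fun _ => ∫ x in (a : ℝ)..(b : ℝ), (x : ℂ) ^ A :=
  .const ((b ^ (A + 1) - a ^ (A + 1)) / (A + 1)) (by rw [integral_pow]; push_cast; rfl)

theorem HasClosedMoments.union {a b c : ℚ} (h₁ : HasClosedMoments a b)
    (h₂ : HasClosedMoments b c) : HasClosedMoments a c := fun A =>
  ⟨fun r => (((h₁ A).1 r).add ((h₂ A).1 r)).congr fun _ hl =>
    (intervalIntegral.integral_add_adjacent_intervals (intervalIntegrable_visits hl r A _ _)
      (intervalIntegrable_visits hl r A _ _)).symm,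
  ((h₁ A).2.add (h₂ A).2).congr fun _ hl =>
    (intervalIntegral.integral_add_adjacent_intervals (intervalIntegrable_U hl A _ _)
      (intervalIntegrable_U hl A _ _)).symm⟩

/-- Only moments of order `l ≤ A` on the image interval enter, so the order of the closed form does
not grow. Since `W_r` is turned into `W_{r-s}`, all `r` have to be carried along. -/
theorem HasClosedMoments.of_shift {a b : ℚ} (hab : a ≤ b) {s : ℤ} (hs : SameFirstDigit s a b)
    (h : HasClosedMoments (2 * a - s) (2 * b - s)) : HasClosedMoments a b := by
  intro A
  have hab' : (a : ℝ) ≤ b := by exact_mod_cast hab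
  have hfac : HasClosedForm A fun lam => lam / 2 ^ (A + 1) :=
    .div .param (.const (2 ^ (A + 1)) (by simp)) fun _ _ => pow_ne_zero _ two_ne_zero
  have hbin : ∀ l, HasClosedForm A fun _ => (A.choose l : ℂ) * (s : ℂ) ^ (A - l) := fun l =>
    .const (A.choose l * s ^ (A - l)) (by push_cast; rfl)
  have hpow := hasClosedForm_integral_pow A a b
  have hv : ∀ r : ℤ, HasClosedForm A fun lam =>
      ∫ x in (a : ℝ)..(b : ℝ), (x : ℂ) ^ A * visits lam r x := by
    intro r
    refine HasClosedForm.congr ?_ fun lam hl => integral_pow_visits hl hab' hs r A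
    refine .add ?_ (.mul hfac (.sum _ fun l hl => .mul (hbin l) ?_))
    · split_ifs
      · exact hpow
      · exact .const 0 (by simp)
    · have := (h l).1 (r - s)
      push_cast at this
      exact this.mono (Nat.lt_succ_iff.1 (Finset.mem_range.1 hl))
  refine ⟨hv, HasClosedForm.congr ?_ fun lam hl => integral_pow_U hl hab' hs A⟩
  refine .add (.sub (hv 0) hpow) (.mul hfac (.sum _ fun l hl => .mul (hbin l) ?_))
  have := (h l).2
  push_cast at this
  exact this.mono (Nat.lt_succ_iff.1 (Finset.mem_range.1 hl))

/-- For `c ≠ 0` the interval lies on one side of 0, with first digit `c.sign`, and doubling maps it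
to an interval of level `N`. -/
theorem HasClosedMoments.dyadic_succ {N : ℕ} {c : ℤ} (hc : c ≠ 0)
    (h : HasClosedMoments ((c - c.sign * 2 ^ N - 1) / 2 ^ N) ((c - c.sign * 2 ^ N + 1) / 2 ^ N)) :
    HasClosedMoments ((c - 1) / 2 ^ (N + 1)) ((c + 1) / 2 ^ (N + 1)) := by
  refine HasClosedMoments.of_shift (s := c.sign) (by gcongr; linarith) ?_ ?_
  · rcases lt_or_gt_of_ne hc with hc | hc
    · refine Or.inr ⟨Int.sign_eq_neg_one_of_neg hc, ?_⟩
      have : (c : ℝ) + 1 ≤ 0 := by exact_mod_cast hc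
      push_cast
      exact div_nonpos_of_nonpos_of_nonneg this (by positivity)
    · refine Or.inl ⟨Int.sign_eq_one_of_pos hc, ?_⟩
      have : (1 : ℝ) ≤ c := by exact_mod_cast hc
      push_cast
      exact div_nonneg (by linarith) (by positivity)
  · convert h using 1 <;> field_simp <;> ring_nf

theorem hasClosedMoments_dyadic (N : ℕ) (c : ℤ) (h₁ : -2 ^ N < c) (h₂ : c < 2 ^ N) :
    HasClosedMoments ((c - 1) / 2 ^ N) ((c + 1) / 2 ^ N) := by
  induction N generalizing c with
  | zero =>
    obtain rfl : c = 0 := by simp at h₁ h₂; omega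
    simpa using hasClosedMoments_neg_one_one
  | succ N ih =>
    have key : ∀ c : ℤ, c ≠ 0 → -2 ^ (N + 1) < c → c < 2 ^ (N + 1) →
        HasClosedMoments ((c - 1) / 2 ^ (N + 1)) ((c + 1) / 2 ^ (N + 1)) := by
      intro c hc h₁ h₂
      refine HasClosedMoments.dyadic_succ hc ?_
      have h2 : (2 : ℤ) ^ (N + 1) = 2 * 2 ^ N := by ring
      have := ih (c - c.sign * 2 ^ N) (by
        rcases lt_or_gt_of_ne hc with hc | hc
        · rw [Int.sign_eq_neg_one_of_neg hc]; linarith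
        · rw [Int.sign_eq_one_of_pos hc]; linarith) (by
        rcases lt_or_gt_of_ne hc with hc | hc
        · rw [Int.sign_eq_neg_one_of_neg hc]; linarith
        · rw [Int.sign_eq_one_of_pos hc]; linarith)
      push_cast at this
      exact this
    -- The interval centred at 0 straddles both digits. Its two halves are the intervals of level `N
    -- + 2` with `c = ±1`; one shift sends them to level `N + 1` with the nonzero centre indices
    -- `±(1 - 2 ^ (N + 1))`, which `key` covers.
    rcases eq_or_ne c 0 with rfl | hc
    · have hpos : (2 : ℤ) ≤ 2 ^ (N + 1) := by
        rw [pow_succ]; linarith [one_le_pow₀ (M₀ := ℤ) (a := 2) (by norm_num) (n := N)]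
      have hl : HasClosedMoments (((-1 : ℤ) - 1) / 2 ^ (N + 1 + 1))
          (((-1 : ℤ) + 1) / 2 ^ (N + 1 + 1)) := by
        refine HasClosedMoments.dyadic_succ (by norm_num) ?_
        have := key (-1 + 2 ^ (N + 1)) (by omega) (by omega) (by omega)
        push_cast at this
        convert this using 2 <;> simp
      have hr : HasClosedMoments (((1 : ℤ) - 1) / 2 ^ (N + 1 + 1))
          (((1 : ℤ) + 1) / 2 ^ (N + 1 + 1)) := by
        refine HasClosedMoments.dyadic_succ (by norm_num) ?_
        have := key (1 - 2 ^ (N + 1)) (by omega) (by omega) (by omega)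
        push_cast at this
        convert this using 2 <;> simp
      have hmid : (((-1 : ℤ) + 1) / 2 ^ (N + 1 + 1) : ℚ) = ((1 : ℤ) - 1) / 2 ^ (N + 1 + 1) := by
        norm_num
      rw [hmid] at hl
      convert hl.union hr using 1 <;> (push_cast; field_simp; norm_num [pow_succ])
    · exact key c hc h₁ h₂

end LoopCounting

theorem corollary1 :
    -- integrals over the dyadic intervals: existence, and closed forms in `lam`
    (∀ (A N : ℕ) (c : ℤ), -2 ^ N < c → c < 2 ^ N →
      (∀ lam : ℂ, ‖lam‖ < 1 →
        IntervalIntegrable (fun x : ℝ => (x : ℂ) ^ A * LoopCounting.U lam x) MeasureTheory.volume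
          (((c : ℝ) - 1) / 2 ^ N) (((c : ℝ) + 1) / 2 ^ N)) ∧
      LoopCounting.HasClosedForm A (fun lam =>
        ∫ x in (((c : ℝ) - 1) / 2 ^ N)..(((c : ℝ) + 1) / 2 ^ N),
          (x : ℂ) ^ A * LoopCounting.U lam x)) ∧
    -- the explicit roots of the quadratics
    (∀ lam : ℂ, ‖lam‖ < 1 → ∀ j : ℕ,
      ‖LoopCounting.root lam j‖ < 1 ∧
      ∀ z : ℂ, ‖z‖ ≤ 1 → (LoopCounting.quad lam j z = 0 ↔ z = LoopCounting.root lam j)) ∧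
    (∀ lam : ℂ, ‖lam‖ < 1 → lam ≠ 0 → Function.Injective (LoopCounting.root lam)) ∧
    -- the sums of residues
    (∀ lam : ℂ, ‖lam‖ < 1 → ∀ n : ℕ,
      LoopCounting.fHat lam n =
        (2 * (Real.pi : ℂ) * Complex.I)⁻¹ * ∮ z in C(0, 1), LoopCounting.f lam n z) ∧
    (∀ n : ℕ, LoopCounting.HasClosedForm n (fun lam => LoopCounting.fHat lam n)) ∧
    -- the explicit formula on `[-1, 1]`
    (∀ lam : ℂ, ‖lam‖ < 1 → ∀ A : ℕ,
      ∫ x in (-1 : ℝ)..1, (x : ℂ) ^ A * LoopCounting.U lam x =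
        LoopCounting.chainSum
          (fun n => 2 ^ n * ((n + 1) * LoopCounting.fHat lam n - 1 - (-1) ^ n) /
            ((n + 1) * (2 ^ n - lam)))
          (fun k l => lam * (k.choose l) * (1 + (-1) ^ (k - l)) / (2 ^ (k + 1) - 2 * lam)) A) := by
  refine ⟨fun A N c h₁ h₂ => ⟨fun lam hl => LoopCounting.intervalIntegrable_U hl A _ _, ?_⟩,
    fun lam hl j => ⟨(LoopCounting.norm_root_le lam j).trans_lt hl,
      fun z hz => LoopCounting.quad_eq_zero_iff hl j hz⟩,
    fun lam _ h0 => LoopCounting.root_injective h0,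
    fun lam hl n => LoopCounting.fHat_eq_circleIntegral hl n,
    LoopCounting.hasClosedForm_fHat,
    fun lam hl A => LoopCounting.integral_U_eq_chainSum hl A⟩
  have := (LoopCounting.hasClosedMoments_dyadic N c h₁ h₂ A).2
  push_cast at this
  exact this
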